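/- **Setting.** Let $Z_1,Z_2,\dots$ be i.i.d. with law $P_0$ in a model $\mathcal M$ of probability measures on $\mathcal Z$. Let $\Theta^*\subseteq\Theta$ be classes of functions $\mathcal O\to\mathcal K$ ($\mathcal O\subseteq\mathbb R^d$, $d\ge 1$, $\mathcal K\subseteq\mathbb R$). For $P\in\mathcal M$ let $G_P:\Theta\to\mathbb R$ be a goodness-of-fit functional, minimized over $\Theta$ by $\theta_P$ and over $\Theta^*$ by $\theta_P^*$; let $\Psi_P=G_P(\theta_P^*)-G_P(\theta_P)$ and $\Psi_0=\Psi_{P_0}$. Let $g:\mathcal K\times\mathbb R\to\mathcal K$ satisfy $g(k,0)=k$, let $\mathcal F\neq\emptyset$ be a class of functions $\mathcal O\to\mathbb R$, let $\mathcal B\subseteq\mathbb R$ be a nondegenerate interval symmetric about $0$, and put $\theta^*_{P,f}(o;\beta)=g(\theta_P^*(o),\beta f(o))$. Assume $\Theta\setminus\Theta^*\subseteq\{\theta^*_{P,f}(\cdot;\beta):f\in\mathcal F,\beta\in\mathcal B\}\subseteq\Theta$ for all $P\in\mathcal M$. Write $G_{P,f}(\beta)=G_P(\theta^*_{P,f}(\cdot;\beta))$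 and $G_{0,f}=G_{P_0,f}$; assume that $G_{0,f}$ is convex on $\mathcal B$ with a minimizer $\beta_{0,f}$ over $\mathcal B$. Derivatives in $\beta$ are taken on $\mathcal B$ and denoted by primes; $o_P$, $O_P$ and weak convergence are understood with outer probabilities and outer expectations. **Conditions on the goodness of fit.** - (A1) $\mathcal M$ is nonparametric at $P_0$ (its tangent space is $L^2_0(P_0)$) and, for all $f\in\mathcal F$, $\beta\in\mathcal B$, $P\mapsto G_{P,f}(\beta)$ is pathwise differentiable at $P_0$ with efficient influence function $\phi_{0,f}(\cdot;\beta)$. - (A2) $G_{0,f}$ and $\phi_{0,f}(z;\cdot)$ are twice differentiable on $\mathcal B$ for all $f$, $z$. - (A3) There are $C_1,C_2>0$ such that, for every family $\{\beta_f\in\mathcal B\}_{f\in\mathcal F}$, if $s=\sup_f\{G_{0,f}(\beta_f)-G_{0,f}(\beta_{0,f})\}<C_1$, then $\sup_f(\beta_{0,f}-\beta_f)^2\le C_2 s$. - (A4) $G'_{0,f}(\beta_{0,f})=0$ for all $f$; there are $\delta,c>0$ with $G''_{0,f}(\beta)\ge c$ for all $f\in\mathcal F$ and $\beta\in\mathcal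 B$ with $|\beta-\beta_{0,f}|\le\delta$; and $G''_{0,f}$ is continuous at $\beta_{0,f}$ uniformly in $f\in\mathcal F$. - (A5) $\{\phi_{0,f}(\cdot;\beta):f\in\mathcal F,\beta\in\mathcal B\}$ and $\{\phi'_{0,f}(\cdot;\beta_{0,f}):f\in\mathcal F\}$ are $P_0$-Donsker. **Conditions on the estimator** $\tilde G_{n,f}(\beta)$. Put $\tilde r_{n,f}(\beta)=\tilde G_{n,f}(\beta)-G_{0,f}(\beta)-\frac1n\sum_{i=1}^n\phi_{0,f}(Z_i;\beta)$. - (B1) $\tilde G_{n,f_1}(0)=\tilde G_{n,f_2}(0)$ for all $f_1,f_2\in\mathcal F$. - (B2) $\sup_{f\in\mathcal F,\beta\in\mathcal B}|\tilde r_{n,f}(\beta)|=o_P(n^{-1/2})$. - (B3) $\tilde G_{n,f}$ is differentiable on $\mathcal B$ and $\sup_{f\in\mathcal F,\beta\in\mathcal B}|\tilde r'_{n,f}(\beta)|=o_P(n^{-1/2})$. - (B4) $\tilde G_{n,f}$ is twice differentiable on $\mathcal B$ and $\sup_{f\in\mathcal F,\beta\in\mathcal B}|\tilde G''_{n,f}(\beta)-G''_{0,f}(\beta)|=o_P(1)$.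 Let $\tilde\beta_{n,f}\in\mathcal B$ satisfy $\sup_{f\in\mathcal F}|\tilde G'_{n,f}(\tilde\beta_{n,f})|=o_P(n^{-1/2})$, and let $\tilde\Psi_n=\sup_{f\in\mathcal F}\{\tilde G_{n,f}(0)-\tilde G_{n,f}(\tilde\beta_{n,f})\}$. **Theorem.** Suppose that $\Psi_0=0$ and that the conditions above hold. Then the supremum defining $\tilde\Psi_n$ is finite with probability tending to one, $\tilde\Psi_n-\Psi_0=O_P(n^{-1})$, and $$n\tilde\Psi_n\ \text{ converges weakly to }\ \sup_{f\in\mathcal F}\Big[\{2G''_{0,f}(0)\}^{-1/2}\,\mathbb H(f)\Big]^2,$$ where $\mathbb H$ is a tight mean zero Gaussian process in $\ell^\infty(\mathcal F)$ (which exists) with covariance $(f_1,f_2)\mapsto E_0[\phi'_{0,f_1}(Z;\beta_{0,f_1})\,\phi'_{0,f_2}(Z;\beta_{0,f_2})]$. -/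

import Mathlib

open MeasureTheory ProbabilityTheory Filter Topology Set
open scoped ENNReal NNReal BoundedContinuousFunction

noncomputable section

/-! ### Outer expectation, weak convergence, stochastic orders -/

/-- Outer expectation of a nonnegative, possibly non-measurable, function. -/
def outerExp {Ω : Type*} [MeasurableSpace Ω] (μ : Measure Ω) (h : Ω → ℝ≥0∞) : ℝ≥0∞ :=
  ⨅ (u : Ω → ℝ≥0∞) (_ : Measurable u) (_ : ∀ ω, h ω ≤ u ω), ∫⁻ ω, u ω ∂μ

/-- Weak convergence (Hoffmann-Jørgensen) of possibly non-measurable maps `X n`, defined on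
probability spaces that may vary with `n`, to the Borel probability law `Q`.
Since `C - h` is again bounded, continuous and nonnegative for a large constant `C`, restricting to
nonnegative test functions loses nothing, and inner expectations converge as well. -/
def WeakConv {Ω : ℕ → Type*} [∀ n, MeasurableSpace (Ω n)] {E : Type*} [TopologicalSpace E]
    [MeasurableSpace E] (μ : ∀ n, Measure (Ω n)) (X : ∀ n, Ω n → E) (Q : Measure E) : Prop :=
  IsProbabilityMeasure Q ∧
    ∀ h : E →ᵇ ℝ≥0,
      Tendsto (fun n => outerExp (μ n) (fun ω => (h (X n ω) : ℝ≥0∞))) atTop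
        (𝓝 (∫⁻ x, (h x : ℝ≥0∞) ∂Q))

/-- `sup_i |X n i| = o_P(a n)`, in outer probability (a measure applied to a set that need not be
measurable is its outer measure; `sup > c` is written as "some index exceeds `c`"). -/
def SupLittleOP {Ω ι : Type*} [MeasurableSpace Ω] (μ : Measure Ω) (X : ℕ → Ω → ι → ℝ)
    (a : ℕ → ℝ) : Prop :=
  ∀ ε : ℝ, 0 < ε → Tendsto (fun n => μ {ω | ∃ i, ε * a n < |X n ω i|}) atTop (𝓝 0)

/-- `X n = O_P(a n)`, in outer probability. -/
def BigOP {Ω : Type*} [MeasurableSpace Ω] (μ : Measure Ω) (X : ℕ → Ω → ℝ) (a : ℕ → ℝ) : Prop :=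
  ∀ ε : ℝ≥0∞, 0 < ε → ∃ C : ℝ, ∀ᶠ n in atTop, μ {ω | C * a n < |X n ω|} ≤ ε

/-! ### The space of bounded functions, Donsker classes, tight Gaussian processes -/

/-- The space `ℓ^∞(ι)` of bounded real functions on `ι`, with the supremum norm. -/
abbrev Linf (ι : Type*) := lp (fun _ : ι => ℝ) (⊤ : ℝ≥0∞)

instance instMeasurableSpaceLinf (ι : Type*) : MeasurableSpace (Linf ι) := borel _

instance instBorelSpaceLinf (ι : Type*) : BorelSpace (Linf ι) := ⟨rfl⟩

/-- The centred values `f_i(z) - P f_i` are bounded in `i`, for every `z`. -/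
def PointwiseBounded {S ι : Type*} [MeasurableSpace S] (P : Measure S) (F : ι → S → ℝ) : Prop :=
  ∀ z, BddAbove (range fun i => |F i z - ∫ y, F i y ∂P|)

theorem memLinf_empirical {S ι : Type*} [MeasurableSpace S] {P : Measure S} {F : ι → S → ℝ}
    (hb : PointwiseBounded P F) (n : ℕ) (z : Fin n → S) :
    Memℓp (E := fun _ : ι => ℝ)
      (fun i => (Real.sqrt n)⁻¹ * ∑ j, (F i (z j) - ∫ y, F i y ∂P)) (⊤ : ℝ≥0∞) := by
  choose c hc using hb
  refine memℓp_infty ⟨(Real.sqrt n)⁻¹ * ∑ j, c (z j), ?_⟩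
  rintro _ ⟨i, rfl⟩
  have h0 : (0 : ℝ) ≤ (Real.sqrt n)⁻¹ := by positivity
  simp only [Real.norm_eq_abs, abs_mul, abs_of_nonneg h0]
  refine mul_le_mul_of_nonneg_left ?_ h0
  exact (Finset.abs_sum_le_sum_abs _ _).trans
    (Finset.sum_le_sum fun j _ => hc (z j) ⟨i, rfl⟩)

/-- The empirical process `√n (P_n - P) f_i`, as an element of `ℓ^∞(ι)`. -/
def empiricalProcess {S ι : Type*} [MeasurableSpace S] {P : Measure S} {F : ι → S → ℝ}
    (hb : PointwiseBounded P F) (n : ℕ) (z : Fin n → S) : Linf ι :=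
  ⟨fun i => (Real.sqrt n)⁻¹ * ∑ j, (F i (z j) - ∫ y, F i y ∂P), memLinf_empirical hb n z⟩

/-- The (indexed) class `F` of square integrable functions is `P`-Donsker: the empirical process of
an i.i.d. sample from `P`, on the product spaces, converges weakly in `ℓ^∞` to a tight Borel law. -/
def IsDonsker {S ι : Type*} [MeasurableSpace S] (P : Measure S) (F : ι → S → ℝ) : Prop :=
  (∀ i, MemLp (F i) 2 P) ∧
    ∃ (hb : PointwiseBounded P F) (Q : Measure (Linf ι)), IsTightMeasureSet {Q} ∧
      WeakConv (fun n => Measure.pi (fun _ : Fin n => P)) (fun n => empiricalProcess hb n) Q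

/-- `Q` is the law, on `ℓ^∞(ι)`, of a tight mean zero Gaussian process with covariance `Sig`.
(These properties determine `Q`.) -/
structure IsTightGaussianLaw {ι : Type*} (Sig : ι → ι → ℝ) (Q : Measure (Linf ι)) : Prop where
  isProb : IsProbabilityMeasure Q
  tight : IsTightMeasureSet {Q}
  gaussian : IsGaussianProcess (fun (i : ι) (x : Linf ι) => x i) Q
  mean_zero : ∀ i, ∫ x, x i ∂Q = 0
  cov : ∀ i j, ∫ x, x i * x j ∂Q = Sig i j

/-! ### Pathwise differentiability and efficient influence functions -/

/-- `t ↦ R t`, `t ≥ 0`, is a one-dimensional sub-model of `M` through `P` at `t = 0`, differentiable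
in quadratic mean with score `s`. The square roots of densities are taken with respect to the
dominating measure `P + R t`. -/
structure IsRegularPath {S : Type*} [MeasurableSpace S] (M : Set (Measure S)) (P : Measure S)
    (R : ℝ → Measure S) (s : S → ℝ) : Prop where
  start : R 0 = P
  mem : ∀ᶠ t in 𝓝[≥] (0 : ℝ), R t ∈ M
  score_memLp : MemLp s 2 P
  qmd : Tendsto (fun t : ℝ => ∫⁻ z, ENNReal.ofReal
      (((Real.sqrt ((R t).rnDeriv (P + R t) z).toReal
          - Real.sqrt (P.rnDeriv (P + R t) z).toReal) / t
        - s z * Real.sqrt (P.rnDeriv (P + R t) z).toReal / 2) ^ 2) ∂(P + R t))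
    (𝓝[>] 0) (𝓝 0)

/-- The scores at `P` of the regular one-dimensional sub-models of `M`. -/
def scores {S : Type*} [MeasurableSpace S] (M : Set (Measure S)) (P : Measure S) : Set (S → ℝ) :=
  {s | ∃ R : ℝ → Measure S, IsRegularPath M P R s}

/-- `h` lies in the tangent space of `M` at `P`, the `L²(P)`-closed linear span of the scores. -/
def InTangentSpace {S : Type*} [MeasurableSpace S] (M : Set (Measure S)) (P : Measure S)
    (h : S → ℝ) : Prop :=
  ∀ ε : ℝ≥0∞, 0 < ε → ∃ a ∈ Submodule.span ℝ (scores M P), eLpNorm (h - a) 2 P < ε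

/-- The model is nonparametric at `P`: its tangent space is all of `L²₀(P)`. -/
def IsNonparametricAt {S : Type*} [MeasurableSpace S] (M : Set (Measure S)) (P : Measure S) :
    Prop :=
  ∀ h : S → ℝ, MemLp h 2 P → ∫ z, h z ∂P = 0 → InTangentSpace M P h

/-- The functional `ψ` is pathwise differentiable at `P` relative to `M`, with efficient influence
function (canonical gradient) `φ`. -/
structure IsEfficientInfluenceFunction {S : Type*} [MeasurableSpace S] (M : Set (Measure S))
    (ψ : Measure S → ℝ) (P : Measure S) (φ : S → ℝ) : Prop where
  memLp : MemLp φ 2 P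
  mean_zero : ∫ z, φ z ∂P = 0
  deriv_along : ∀ (R : ℝ → Measure S) (s : S → ℝ), IsRegularPath M P R s →
    HasDerivWithinAt (fun t => ψ (R t)) (∫ z, φ z * s z ∂P) (Ici 0) 0
  tangent : InTangentSpace M P φ

/-! ### Goodness of fit, sub-models, improvement in fit -/

/-- The framework: a model `M`; functions on `O ⊆ ℝ^d` with values in `K ⊆ ℝ`; the full class `Th`
and the reduced class `ThR`; a goodness of fit `G P` (its values off `Th` play no role), with
minimizers `th P` over `Th` and `thR P` over `ThR`; the map `g` that generates one-dimensional
sub-models; the class `F` of directions and the symmetric interval `B`. The sub-models stay in `Th`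
and exhaust the part of `Th` outside `ThR` (at `β = 0` they pass through `thR P`). -/
structure FitFramework (S : Type*) [MeasurableSpace S] (d : ℕ) where
  M : Set (Measure S)
  isProb : ∀ P ∈ M, IsProbabilityMeasure P
  O : Set (EuclideanSpace ℝ (Fin d))
  K : Set ℝ
  Th : Set (O → K)
  ThR : Set (O → K)
  subset : ThR ⊆ Th
  G : Measure S → (O → K) → ℝ
  th : Measure S → O → K
  th_mem : ∀ P ∈ M, th P ∈ Th
  th_min : ∀ P ∈ M, ∀ t ∈ Th, G P (th P) ≤ G P t
  thR : Measure S → O → K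
  thR_mem : ∀ P ∈ M, thR P ∈ ThR
  thR_min : ∀ P ∈ M, ∀ t ∈ ThR, G P (thR P) ≤ G P t
  g : K → ℝ → K
  g_zero : ∀ k, g k 0 = k
  F : Set (O → ℝ)
  F_nonempty : F.Nonempty
  B : Set ℝ
  B_interval : B.OrdConnected
  B_symm : ∀ b ∈ B, -b ∈ B
  B_nontrivial : B.Nontrivial
  sub_mem : ∀ P ∈ M, ∀ f ∈ F, ∀ b ∈ B, (fun o => g (thR P o) (b * f o)) ∈ Th
  sub_exhaust : ∀ P ∈ M, ∀ t ∈ Th \ ThR, ∃ f ∈ F, ∃ b ∈ B, t = fun o => g (thR P o) (b * f o)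

namespace FitFramework

variable {S : Type*} [MeasurableSpace S] {d : ℕ} (A : FitFramework S d)

/-- The one-dimensional sub-model through `thR P` in direction `f`, at `b`. -/
def sub (P : Measure S) (f : A.F) (b : ℝ) : A.O → A.K := fun o => A.g (A.thR P o) (b * f.1 o)

/-- The goodness of fit along the sub-model. -/
def Gsub (P : Measure S) (f : A.F) (b : ℝ) : ℝ := A.G P (A.sub P f b)

/-- The improvement in fit. -/
def Psi (P : Measure S) : ℝ := A.G P (A.thR P) - A.G P (A.th P)

/-- First derivative of a function of `b ∈ B` (one-sided at an endpoint of `B`). -/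
def D1 (u : ℝ → ℝ) (b : ℝ) : ℝ := derivWithin u A.B b

/-- Second derivative of a function of `b ∈ B`. -/
def D2 (u : ℝ → ℝ) (b : ℝ) : ℝ := derivWithin (derivWithin u A.B) A.B b

/-- Twice differentiable on `B`. -/
def TwiceDiff (u : ℝ → ℝ) : Prop :=
  DifferentiableOn ℝ u A.B ∧ DifferentiableOn ℝ (derivWithin u A.B) A.B

/-- Deterministic conditions on the goodness of fit at the true distribution `P₀`, with `b₀ f` the
minimizer of `G_{P₀,f}` over `B` and `φ f b` the influence function at `(f, b)`. -/
structure GoodnessConditions (P₀ : Measure S) (b₀ : A.F → ℝ) (φ : A.F → ℝ → S → ℝ) : Prop where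
  b₀_mem : ∀ f, b₀ f ∈ A.B
  b₀_min : ∀ f, IsMinOn (A.Gsub P₀ f) A.B (b₀ f)
  convex : ∀ f, ConvexOn ℝ A.B (A.Gsub P₀ f)
  nonparametric : IsNonparametricAt A.M P₀
  eif : ∀ f, ∀ b ∈ A.B,
    IsEfficientInfluenceFunction A.M (fun P => A.Gsub P f b) P₀ (φ f b)
  smooth_G : ∀ f, A.TwiceDiff (A.Gsub P₀ f)
  smooth_φ : ∀ f z, A.TwiceDiff (fun b => φ f b z)
  quadratic_growth : ∃ C₁ C₂ : ℝ, 0 < C₁ ∧ 0 < C₂ ∧ ∀ (b : A.F → ℝ) (s : ℝ), (∀ f, b f ∈ A.B) →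
    IsLUB (range fun f => A.Gsub P₀ f (b f) - A.Gsub P₀ f (b₀ f)) s → s < C₁ →
      ∀ f, (b₀ f - b f) ^ 2 ≤ C₂ * s
  stationary : ∀ f, A.D1 (A.Gsub P₀ f) (b₀ f) = 0
  curvature_pos : ∃ δ c : ℝ, 0 < δ ∧ 0 < c ∧ ∀ f, ∀ b ∈ A.B, |b - b₀ f| ≤ δ →
    c ≤ A.D2 (A.Gsub P₀ f) b
  curvature_cont : ∀ ε : ℝ, 0 < ε → ∃ δ : ℝ, 0 < δ ∧ ∀ f, ∀ b ∈ A.B, |b - b₀ f| ≤ δ →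
    |A.D2 (A.Gsub P₀ f) b - A.D2 (A.Gsub P₀ f) (b₀ f)| ≤ ε
  donsker : IsDonsker P₀ (fun (p : A.F × A.B) => φ p.1 p.2)
  donsker_deriv : IsDonsker P₀ (fun (f : A.F) z => A.D1 (fun b => φ f b z) (b₀ f))

/-- Remainder of the asymptotically linear expansion of the estimator `Gt n ω f b`. -/
def remainder {Ω : Type*} (P₀ : Measure S) (φ : A.F → ℝ → S → ℝ) (Z : ℕ → Ω → S)
    (Gt : ℕ → Ω → A.F → ℝ → ℝ) (n : ℕ) (ω : Ω) (f : A.F) (b : ℝ) : ℝ :=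
  (Gt n ω f b - A.Gsub P₀ f b) - (1 / (n : ℝ)) * ∑ i ∈ Finset.range n, φ f b (Z i ω)

/-- Stochastic conditions on the estimator `Gt n ω f b` of the goodness of fit `G_{P₀,f}(b)`. -/
structure EstimatorConditions {Ω : Type*} [MeasurableSpace Ω] (μ : Measure Ω) (P₀ : Measure S)
    (φ : A.F → ℝ → S → ℝ) (Z : ℕ → Ω → S) (Gt : ℕ → Ω → A.F → ℝ → ℝ) : Prop where
  common_value : ∀ n ω f₁ f₂, Gt n ω f₁ 0 = Gt n ω f₂ 0
  linear : SupLittleOP μ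
    (fun n ω (p : A.F × A.B) => A.remainder P₀ φ Z Gt n ω p.1 p.2)
    (fun n => (n : ℝ) ^ (-(1 / 2) : ℝ))
  smooth : ∀ n ω f, A.TwiceDiff (Gt n ω f)
  linear_deriv : SupLittleOP μ
    (fun n ω (p : A.F × A.B) => A.D1 (A.remainder P₀ φ Z Gt n ω p.1) p.2)
    (fun n => (n : ℝ) ^ (-(1 / 2) : ℝ))
  second_deriv : SupLittleOP μ
    (fun n ω (p : A.F × A.B) => A.D2 (Gt n ω p.1) p.2 - A.D2 (A.Gsub P₀ p.1) p.2)
    (fun _ => 1)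

/-- `bt n ω f ∈ B` nearly solves the estimating equation `Gt' = 0`, uniformly in `f`. -/
structure IsApproxStationary {Ω : Type*} [MeasurableSpace Ω] (μ : Measure Ω)
    (Gt : ℕ → Ω → A.F → ℝ → ℝ) (bt : ℕ → Ω → A.F → ℝ) : Prop where
  mem : ∀ n ω f, bt n ω f ∈ A.B
  small : SupLittleOP μ (fun n ω f => A.D1 (Gt n ω f) (bt n ω f))
    (fun n => (n : ℝ) ^ (-(1 / 2) : ℝ))

/-- The bias-corrected estimator of the improvement in fit. -/
def PsiEst {Ω : Type*} (Gt : ℕ → Ω → A.F → ℝ → ℝ) (bt : ℕ → Ω → A.F → ℝ) (n : ℕ) (ω : Ω) : ℝ :=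
  ⨆ f : A.F, (Gt n ω f 0 - Gt n ω f (bt n ω f))

/-- The covariance `E₀[φ'_{f₁}(Z; b₀ f₁) φ'_{f₂}(Z; b₀ f₂)]`. -/
def limitCov (P₀ : Measure S) (b₀ : A.F → ℝ) (φ : A.F → ℝ → S → ℝ) (f₁ f₂ : A.F) : ℝ :=
  ∫ z, A.D1 (fun b => φ f₁ b z) (b₀ f₁) * A.D1 (fun b => φ f₂ b z) (b₀ f₂) ∂P₀

end FitFramework

end

/-!
Under the null hypothesis `Ψ₀ = 0` every sub-model is fitted best at `β = 0`, and quadratic growth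
makes `0` the only minimizer, so `β₀ = 0`. All estimates then take place near the origin,
uniformly in the direction `f`.

*Consistency.* By the Donsker property and the linear expansion, `G̃ - G₀` is uniformly
`o_P(1)`, and so is its second derivative by assumption. Landau's interpolation inequality
(`abs_deriv_le_of_abs_le`) gives the same for the first derivative, even when `B` is unbounded.
Since `G₀` is convex with curvature bounded below near `0`, the nearly stationary points `β̃` tend
to `0` uniformly (`FitFramework.eventually_abs_bt_le`).

*Centring.* The averages of `φ'_f(Z_i; 0)` converge to the mean of `φ'_f(·; 0)`. By the expansion
of `G̃'` they equal `G̃'_f(0) + o_P(1)`, which tends to `G₀'_f(0) = 0`. So the mean vanishes, without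
any interchange of derivative and integral (`FitFramework.integral_D1_influence_eq_zero`), and
`√n G̃'_f(0)` is, up to `o_P(1)`, the empirical process `W_n(f)` of the functions `φ'_f(·; 0)`.

*Quadratic approximation.* Taylor expansion around `β̃` shows that `n (G̃_f(0) - G̃_f(β̃))` is
`W_n(f)² / (2 G₀''_f(0)) + o_P(1)`, uniformly in `f` (`abs_scaled_drop_sub_le`,
`FitFramework.eventually_abs_drop_sub_le`). The suprema over `f` are therefore close, and the
supremum of the quadratic expression is continuous in `W_n`.

*Limit law.* Weak convergence of `W_n` is assumed on the product spaces only. It passes to the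
sample `Z` because outer expectations decrease and inner expectations increase under composition
with a measurable map (`WeakConv.comp_sample`). The central limit theorem for linear combinations
identifies the limit as Gaussian (`isTightGaussianLaw_of_weakConv`). The continuous mapping theorem
and Slutsky's lemma (`WeakConv.of_dist_le`) conclude.
-/

/-! ### Outer expectations -/

section OuterExpectation

variable {Ω Ω' : Type*} [MeasurableSpace Ω] [MeasurableSpace Ω'] {μ : Measure Ω}

theorem outerExp_le_lintegral {h u : Ω → ℝ≥0∞} (hu : Measurable u) (hle : ∀ ω, h ω ≤ u ω) :
    outerExp μ h ≤ ∫⁻ ω, u ω ∂μ :=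
  iInf_le_of_le u (iInf_le_of_le hu (iInf_le _ hle))

theorem le_outerExp {h : Ω → ℝ≥0∞} {c : ℝ≥0∞}
    (hc : ∀ u : Ω → ℝ≥0∞, Measurable u → (∀ ω, h ω ≤ u ω) → c ≤ ∫⁻ ω, u ω ∂μ) :
    c ≤ outerExp μ h :=
  le_iInf fun u => le_iInf fun hu => le_iInf fun hle => hc u hu hle

theorem outerExp_mono {h k : Ω → ℝ≥0∞} (hle : ∀ ω, h ω ≤ k ω) : outerExp μ h ≤ outerExp μ k :=
  le_outerExp fun _ hu hk => outerExp_le_lintegral hu fun ω => (hle ω).trans (hk ω)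

theorem outerExp_add_le (h k : Ω → ℝ≥0∞) :
    outerExp μ (fun ω => h ω + k ω) ≤ outerExp μ h + outerExp μ k := by
  simp only [outerExp, ENNReal.iInf_add, ENNReal.add_iInf]
  refine le_iInf fun v => le_iInf fun hv => le_iInf fun hkv =>
    le_iInf fun u => le_iInf fun hu => le_iInf fun hhu => ?_
  rw [← lintegral_add_left hu]
  exact outerExp_le_lintegral (hu.add hv) fun ω => add_le_add (hhu ω) (hkv ω)

theorem outerExp_const [IsProbabilityMeasure μ] (c : ℝ≥0∞) : outerExp μ (fun _ => c) = c := by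
  refine le_antisymm ?_ (le_outerExp fun u _ hle => ?_)
  · simpa using outerExp_le_lintegral (μ := μ) (measurable_const (a := c)) fun _ => le_rfl
  · simpa using lintegral_mono (μ := μ) hle

theorem outerExp_eq_lintegral {h : Ω → ℝ≥0∞} (hh : AEMeasurable h μ) :
    outerExp μ h = ∫⁻ ω, h ω ∂μ := by
  refine le_antisymm ?_ (le_outerExp fun u _ hle => lintegral_mono hle)
  -- a measurable majorant: the measurable version of `h`, raised to `∞` on a null set
  have hnull : μ {ω | h ω ≠ hh.mk h ω} = 0 := hh.ae_eq_mk
  set N := toMeasurable μ {ω | h ω ≠ hh.mk h ω} with hN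
  have hN0 : μ N = 0 := by rw [hN, measure_toMeasurable, hnull]
  have hNm : MeasurableSet N := measurableSet_toMeasurable _ _
  have hle : ∀ ω, h ω ≤ hh.mk h ω + N.indicator (fun _ => ∞) ω := by
    intro ω
    by_cases hω : ω ∈ N
    · simp [hω]
    · have : h ω = hh.mk h ω := by
        by_contra hne
        exact hω (subset_toMeasurable _ _ hne)
      simp [hω, this]
  refine (outerExp_le_lintegral
    (hh.measurable_mk.add (measurable_const.indicator hNm)) hle).trans ?_
  simp only [Pi.add_apply]
  rw [lintegral_add_left hh.measurable_mk, lintegral_indicator hNm,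
    lintegral_congr_ae hh.ae_eq_mk]
  simp [hN0]

theorem outerExp_indicator_const_le (s : Set Ω) (c : ℝ≥0∞) :
    outerExp μ (s.indicator fun _ => c) ≤ c * μ s := by
  refine (outerExp_le_lintegral (u := (toMeasurable μ s).indicator fun _ => c)
    (measurable_const.indicator (measurableSet_toMeasurable _ _)) fun ω => ?_).trans ?_
  · exact indicator_le_indicator_of_subset (subset_toMeasurable _ _) (fun _ => zero_le) ω
  · rw [lintegral_indicator_const (measurableSet_toMeasurable _ _), measure_toMeasurable]

theorem measure_le_outerExp {h : Ω → ℝ≥0∞} {s : Set Ω} (hs : ∀ ω ∈ s, 1 ≤ h ω) :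
    μ s ≤ outerExp μ h := by
  refine le_outerExp fun u hu hle => ?_
  calc μ s ≤ μ {ω | 1 ≤ u ω} := measure_mono fun ω hω => (hs ω hω).trans (hle ω)
    _ = 1 * μ {ω | 1 ≤ u ω} := (one_mul _).symm
    _ ≤ ∫⁻ ω, u ω ∂μ := mul_meas_ge_le_lintegral hu 1

/-- Strict inequality is possible: a function of `ζ` may have measurable majorants that do not
factor through `ζ`. -/
theorem outerExp_comp_le {ζ : Ω → Ω'} (hζ : Measurable ζ) (h : Ω' → ℝ≥0∞) :
    outerExp μ (fun ω => h (ζ ω)) ≤ outerExp (μ.map ζ) h := by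
  refine le_outerExp fun u hu hle => ?_
  rw [lintegral_map hu hζ]
  exact outerExp_le_lintegral (hu.comp hζ) fun ω => hle (ζ ω)

end OuterExpectation

/-! ### Events of outer probability tending to one -/

section WithHighProbability

variable {Ω : Type*} [MeasurableSpace Ω] {μ : Measure Ω}

/-- The filter of events, depending on the sample size `n`, whose complement has outer probability
tending to zero. -/
def withHighProb (μ : Measure Ω) : Filter (ℕ × Ω) where
  sets := {s | Tendsto (fun n => μ {ω | (n, ω) ∉ s}) atTop (𝓝 0)}
  univ_sets := by simp
  sets_of_superset {s t} hs hst :=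
    tendsto_of_tendsto_of_tendsto_of_le_of_le tendsto_const_nhds hs (fun _ => zero_le)
      fun _ => measure_mono fun _ hω h => hω (hst h)
  inter_sets {s t} hs ht := by
    have hadd := Tendsto.add hs ht
    rw [add_zero] at hadd
    refine tendsto_of_tendsto_of_tendsto_of_le_of_le tendsto_const_nhds hadd (fun _ => zero_le)
      fun n => (measure_mono fun ω hω => ?_).trans (measure_union_le _ _)
    by_cases h : (n, ω) ∈ s
    · exact Or.inr fun h' => hω ⟨h, h'⟩
    · exact Or.inl h

theorem eventually_withHighProb {q : ℕ × Ω → Prop} :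
    (∀ᶠ p in withHighProb μ, q p) ↔ Tendsto (fun n => μ {ω | ¬ q (n, ω)}) atTop (𝓝 0) :=
  Iff.rfl

theorem tendsto_fst_withHighProb : Tendsto Prod.fst (withHighProb μ) atTop := by
  intro s hs
  refine tendsto_const_nhds.congr' ?_
  filter_upwards [hs] with n hn
  simp [hn]

theorem eventually_pos_withHighProb : ∀ᶠ p in withHighProb μ, 0 < p.1 :=
  tendsto_fst_withHighProb.eventually (eventually_gt_atTop 0)

/-- A deterministic statement holds if it holds with high probability. -/
theorem of_eventually_withHighProb [IsProbabilityMeasure μ] {q : Prop}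
    (h : ∀ᶠ _p in withHighProb μ, q) : q := by
  by_contra hq
  rw [eventually_withHighProb] at h
  simp [hq] at h

theorem SupLittleOP.eventually {ι : Type*} {X : ℕ → Ω → ι → ℝ} {a : ℕ → ℝ}
    (h : SupLittleOP μ X a) {ε : ℝ} (hε : 0 < ε) :
    ∀ᶠ p in withHighProb μ, ∀ i, |X p.1 p.2 i| ≤ ε * a p.1 := by
  rw [eventually_withHighProb]
  simpa using h ε hε

/-- What holds with high probability on every event `|W| ≤ C`, holds with high probability if `W`
is stochastically bounded. -/
theorem BigOP.eventually {W : ℕ → Ω → ℝ} (hW : BigOP μ W fun _ => 1) {q : ℕ × Ω → Prop}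
    (h : ∀ C : ℝ, ∀ᶠ p in withHighProb μ, |W p.1 p.2| ≤ C → q p) :
    ∀ᶠ p in withHighProb μ, q p := by
  rw [eventually_withHighProb, ENNReal.tendsto_nhds_zero]
  intro ε hε
  have hε2 : 0 < ε / 2 := ENNReal.half_pos hε.ne'
  obtain ⟨C, hC⟩ := hW (ε / 2) hε2
  have h' := ENNReal.tendsto_nhds_zero.1 (eventually_withHighProb.1 (h C)) (ε / 2) hε2
  filter_upwards [hC, h'] with n h1 h2
  calc μ {ω | ¬ q (n, ω)}
      ≤ μ ({ω | C * 1 < |W n ω|} ∪ {ω | ¬ (|W n ω| ≤ C → q (n, ω))}) := by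
        refine measure_mono fun ω hω => ?_
        by_cases hc : |W n ω| ≤ C
        · exact Or.inr fun hq => hω (hq hc)
        · exact Or.inl (by simpa using hc)
    _ ≤ ε / 2 + ε / 2 := (measure_union_le _ _).trans (add_le_add h1 h2)
    _ = ε := ENNReal.add_halves ε

theorem BigOP.congr_norm {W : ℕ → Ω → ℝ} (hW : BigOP μ W fun _ => 1) {r : ℕ → ℝ}
    {X : ℕ → Ω → ℝ} (h : ∀ᶠ n in atTop, ∀ ω, |X n ω| = |W n ω| * r n) (hr : ∀ n, 0 ≤ r n) :
    BigOP μ X r := by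
  intro ε hε
  obtain ⟨C, hC⟩ := hW ε hε
  refine ⟨C, ?_⟩
  filter_upwards [hC, h] with n hn hX
  refine (measure_mono fun ω hω => ?_).trans hn
  have hω' : C * r n < |W n ω| * r n := by rw [← hX ω]; exact hω
  simpa using lt_of_mul_lt_mul_right hω' (hr n)

end WithHighProbability

/-! ### Weak convergence of non-measurable maps -/

section WeakConvergence

theorem WeakConv.map {Ω : ℕ → Type*} [∀ n, MeasurableSpace (Ω n)] {E F : Type*}
    [TopologicalSpace E] [MeasurableSpace E] [BorelSpace E] [TopologicalSpace F]
    [MeasurableSpace F] [BorelSpace F] {μ : ∀ n, Measure (Ω n)} {X : ∀ n, Ω n → E}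
    {Q : Measure E} (h : WeakConv μ X Q) {T : E → F} (hT : Continuous T) :
    WeakConv μ (fun n ω => T (X n ω)) (Q.map T) := by
  have := h.1
  refine ⟨Measure.isProbabilityMeasure_map hT.measurable.aemeasurable, fun k => ?_⟩
  rw [lintegral_map (by fun_prop) hT.measurable]
  exact h.2 (k.compContinuous ⟨T, hT⟩)

/-- Weak convergence of statistics on the sample spaces entails weak convergence of the statistics
of a sample. Outer expectations can only decrease when a statistic is composed with the sample,
and inner expectations can only increase, and both have the same limit. -/
theorem WeakConv.comp_sample {Ω : Type*} [MeasurableSpace Ω] {μ : Measure Ω}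
    [IsProbabilityMeasure μ] {S : ℕ → Type*} [∀ n, MeasurableSpace (S n)] {E : Type*}
    [TopologicalSpace E] [MeasurableSpace E] [BorelSpace E] {ν : ∀ n, Measure (S n)}
    {X : ∀ n, S n → E} {Q : Measure E} (h : WeakConv ν X Q) {ζ : ∀ n, Ω → S n}
    (hζ : ∀ n, Measurable (ζ n)) (hν : ∀ n, μ.map (ζ n) = ν n) :
    WeakConv (fun _ => μ) (fun n ω => X n (ζ n ω)) Q := by
  have := h.1
  refine ⟨h.1, fun k => ?_⟩
  obtain ⟨C, hC⟩ : ∃ C : ℝ≥0, ∀ x, k x ≤ C := by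
    obtain ⟨C, hC⟩ := k.isBounded_range.bddAbove
    exact ⟨C, fun x => hC ⟨x, rfl⟩⟩
  let k' : E →ᵇ ℝ≥0 := BoundedContinuousFunction.mkOfBound
    ⟨fun x => C - k x, by fun_prop⟩ C fun x y => by
      rw [NNReal.dist_eq, abs_le]
      have h1 : ((C - k x : ℝ≥0) : ℝ) ≤ C := by exact_mod_cast tsub_le_self
      have h2 : ((C - k y : ℝ≥0) : ℝ) ≤ C := by exact_mod_cast tsub_le_self
      constructor
      · change -(C : ℝ) ≤ ((C - k x : ℝ≥0) : ℝ) - ((C - k y : ℝ≥0) : ℝ)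
        linarith [NNReal.coe_nonneg (C - k x)]
      · change ((C - k x : ℝ≥0) : ℝ) - ((C - k y : ℝ≥0) : ℝ) ≤ C
        linarith [NNReal.coe_nonneg (C - k y)]
  have hkk' : ∀ x, (k x : ℝ≥0∞) + k' x = C := fun x => by
    have : k x + (C - k x) = C := add_tsub_cancel_of_le (hC x)
    exact_mod_cast this
  have hint : ∫⁻ x, (k x : ℝ≥0∞) ∂Q = C - ∫⁻ x, (k' x : ℝ≥0∞) ∂Q := by
    have hsum : ∫⁻ x, (k x : ℝ≥0∞) ∂Q + ∫⁻ x, (k' x : ℝ≥0∞) ∂Q = C := by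
      rw [← lintegral_add_left (by fun_prop)]
      simp [hkk']
    rw [← hsum, ENNReal.add_sub_cancel_right (k'.lintegral_lt_top_of_nnreal Q).ne]
  have hlow : Tendsto (fun n => (C : ℝ≥0∞) - outerExp (ν n) fun z => (k' (X n z) : ℝ≥0∞)) atTop
      (𝓝 (∫⁻ x, (k x : ℝ≥0∞) ∂Q)) := by
    rw [hint]
    exact ENNReal.Tendsto.sub tendsto_const_nhds (h.2 k') (Or.inl ENNReal.coe_ne_top)
  refine tendsto_of_tendsto_of_tendsto_of_le_of_le hlow (h.2 k) (fun n => ?_) fun n => ?_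
  · refine tsub_le_iff_right.2 ?_
    calc (C : ℝ≥0∞) = outerExp μ fun ω => (k (X n (ζ n ω)) : ℝ≥0∞) + k' (X n (ζ n ω)) := by
          simp only [hkk', outerExp_const]
      _ ≤ outerExp μ (fun ω => (k (X n (ζ n ω)) : ℝ≥0∞))
          + outerExp μ (fun ω => (k' (X n (ζ n ω)) : ℝ≥0∞)) := outerExp_add_le _ _
      _ ≤ _ := by
          gcongr
          rw [← hν n]
          exact outerExp_comp_le (hζ n) fun z => (k' (X n z) : ℝ≥0∞)
  · change outerExp μ (fun ω => (k (X n (ζ n ω)) : ℝ≥0∞)) ≤ _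
    rw [← hν n]
    exact outerExp_comp_le (hζ n) fun z => (k (X n z) : ℝ≥0∞)

variable {Ω : Type*} [MeasurableSpace Ω] {μ : Measure Ω}

/-- A weakly convergent sequence is stochastically bounded. -/
theorem WeakConv.bigOP_norm {E : Type*} [NormedAddCommGroup E] [MeasurableSpace E] [BorelSpace E]
    {X : ℕ → Ω → E} {Q : Measure E} (h : WeakConv (fun _ => μ) X Q) :
    BigOP μ (fun n ω => ‖X n ω‖) fun _ => 1 := by
  have := h.1
  intro ε hε
  obtain ⟨k, hk⟩ : ∃ k : ℕ, Q {x | (k : ℝ) ≤ ‖x‖} < ε := by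
    have hanti : Antitone fun k : ℕ => {x : E | (k : ℝ) ≤ ‖x‖} := fun i j hij x hx =>
      le_trans (Nat.cast_le.2 hij : (i : ℝ) ≤ j) hx
    have hlim := tendsto_measure_iInter_atTop (μ := Q)
      (fun k : ℕ => (measurableSet_le measurable_const measurable_norm).nullMeasurableSet) hanti
      ⟨0, measure_ne_top _ _⟩
    have hempty : ⋂ k : ℕ, {x : E | (k : ℝ) ≤ ‖x‖} = ∅ := by
      ext x
      obtain ⟨k, hk⟩ := exists_nat_gt ‖x‖
      simp only [mem_iInter, mem_ofPred_eq, mem_empty_iff_false, iff_false, not_forall, not_le]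
      exact ⟨k, hk⟩
    rw [hempty, measure_empty] at hlim
    exact ((tendsto_order.1 hlim).2 ε hε).exists
  -- a continuous function between the indicators of `‖x‖ ≥ k + 1` and `‖x‖ ≥ k`
  let t : E →ᵇ ℝ≥0 := BoundedContinuousFunction.mkOfBound
    ⟨fun x => min 1 (Real.toNNReal (‖x‖ - k)), by fun_prop⟩ 1 fun x y => by
      rw [NNReal.dist_eq, abs_le]
      have h1 : ((min 1 (Real.toNNReal (‖x‖ - k)) : ℝ≥0) : ℝ) ≤ 1 := by
        exact_mod_cast min_le_left _ _
      have h2 : ((min 1 (Real.toNNReal (‖y‖ - k)) : ℝ≥0) : ℝ) ≤ 1 := by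
        exact_mod_cast min_le_left _ _
      have h3 := NNReal.coe_nonneg (min 1 (Real.toNNReal (‖x‖ - k)))
      have h4 := NNReal.coe_nonneg (min 1 (Real.toNNReal (‖y‖ - k)))
      simp only [ContinuousMap.coe_mk]
      constructor <;> linarith
  have ht : ∀ x, t x = min 1 (Real.toNNReal (‖x‖ - k)) := fun _ => rfl
  have hint : ∫⁻ x, (t x : ℝ≥0∞) ∂Q < ε := by
    refine lt_of_le_of_lt ?_ hk
    rw [← lintegral_indicator_one (measurableSet_le measurable_const measurable_norm)]
    refine lintegral_mono fun x => ?_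
    by_cases hx : (k : ℝ) ≤ ‖x‖
    · rw [indicator_of_mem (by exact hx), ht, Pi.one_apply]
      exact ENNReal.coe_le_one_iff.2 (min_le_left _ _)
    · rw [ht, Real.toNNReal_of_nonpos (by linarith [not_le.1 hx])]
      simp
  refine ⟨k + 1, ?_⟩
  filter_upwards [(tendsto_order.1 (h.2 t)).2 ε hint] with n hn
  refine (measure_le_outerExp fun ω hω => ?_).trans hn.le
  have hω' : (k : ℝ) + 1 < ‖X n ω‖ := by simpa using hω
  have h1 : (1 : ℝ≥0) ≤ Real.toNNReal (‖X n ω‖ - k) := by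
    rw [Real.one_le_toNNReal]
    linarith
  rw [ht, min_eq_left h1]
  simp

/-- Outer expectations of `k (X ω)` and `k (Y ω)` are close if the integrands are, off a set `s` of
small outer probability; `s` need not be measurable. -/
theorem outerExp_le_add_of_forall_notMem_le [IsProbabilityMeasure μ] (k : ℝ →ᵇ ℝ≥0) {C : ℝ≥0}
    (hC : ∀ x, k x ≤ C) {X Y : Ω → ℝ} {η : ℝ≥0} {s : Set Ω}
    (hs : ∀ ω ∉ s, k (X ω) ≤ k (Y ω) + η) :
    outerExp μ (fun ω => (k (X ω) : ℝ≥0∞))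
      ≤ outerExp μ (fun ω => (k (Y ω) : ℝ≥0∞)) + (η + C * μ s) := by
  calc outerExp μ (fun ω => (k (X ω) : ℝ≥0∞))
      ≤ outerExp μ (fun ω => (k (Y ω) : ℝ≥0∞) + (η + s.indicator (fun _ => (C : ℝ≥0∞)) ω)) := by
        refine outerExp_mono fun ω => ?_
        by_cases hω : ω ∈ s
        · rw [indicator_of_mem hω]
          refine le_trans ?_ (le_add_self.trans le_add_self)
          exact_mod_cast hC _
        · rw [indicator_of_notMem hω, add_zero]
          exact_mod_cast hs ω hω
    _ ≤ outerExp μ (fun ω => (k (Y ω) : ℝ≥0∞))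
        + (outerExp μ (fun _ => (η : ℝ≥0∞)) + outerExp μ (s.indicator fun _ => (C : ℝ≥0∞))) :=
        (outerExp_add_le _ _).trans (by gcongr; exact outerExp_add_le _ _)
    _ ≤ _ := by
        rw [outerExp_const]
        gcongr
        exact outerExp_indicator_const_le _ _

/-- Slutsky's lemma for real-valued non-measurable maps. -/
theorem WeakConv.of_dist_le [IsProbabilityMeasure μ] {X Y : ℕ → Ω → ℝ} {Q : Measure ℝ}
    (hY : WeakConv (fun _ => μ) Y Q)
    (hXY : ∀ ε : ℝ, 0 < ε → ∀ᶠ p in withHighProb μ, |X p.1 p.2 - Y p.1 p.2| ≤ ε) :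
    WeakConv (fun _ => μ) X Q := by
  have := hY.1
  refine ⟨hY.1, fun k => ?_⟩
  obtain ⟨C, hC⟩ : ∃ C : ℝ≥0, ∀ x, k x ≤ C := by
    obtain ⟨C, hC⟩ := k.isBounded_range.bddAbove
    exact ⟨C, fun x => hC ⟨x, rfl⟩⟩
  -- `k` is uniformly continuous on bounded sets only, so stochastic boundedness of `Y` is needed
  have hclose : ∀ η : ℝ≥0, 0 < η → ∀ᶠ p in withHighProb μ,
      k (X p.1 p.2) ≤ k (Y p.1 p.2) + η ∧ k (Y p.1 p.2) ≤ k (X p.1 p.2) + η := by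
    intro η hη
    refine hY.bigOP_norm.eventually fun R => ?_
    have huc := (isCompact_Icc (a := -(R + 1)) (b := R + 1)).uniformContinuousOn_of_continuous
      k.continuous.continuousOn
    obtain ⟨δ, hδ, hk⟩ := Metric.uniformContinuousOn_iff.1 huc η hη
    filter_upwards [hXY (min (δ / 2) 1) (by positivity)] with p hp hR
    have h1 := hp.trans (min_le_left _ _)
    have h2 := hp.trans (min_le_right _ _)
    rw [Real.norm_eq_abs, abs_abs] at hR
    rw [abs_le] at hR h2
    have hd := hk (X p.1 p.2) ⟨by linarith, by linarith⟩ (Y p.1 p.2) ⟨by linarith, by linarith⟩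
      (by rw [Real.dist_eq]; linarith)
    rw [NNReal.dist_eq, abs_lt] at hd
    constructor <;> rw [← NNReal.coe_le_coe, NNReal.coe_add] <;> linarith
  have hCtop : ∀ η : ℝ≥0, 0 < η → ∀ᶠ n in atTop,
      outerExp μ (fun ω => (k (X n ω) : ℝ≥0∞)) ≤
        outerExp μ (fun ω => (k (Y n ω) : ℝ≥0∞)) + (η + η) ∧
      outerExp μ (fun ω => (k (Y n ω) : ℝ≥0∞)) ≤
        outerExp μ (fun ω => (k (X n ω) : ℝ≥0∞)) + (η + η) := by
    intro η hη
    have hlim := ENNReal.Tendsto.const_mul (a := (C : ℝ≥0∞))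
      (eventually_withHighProb.1 (hclose η hη)) (Or.inr ENNReal.coe_ne_top)
    rw [mul_zero] at hlim
    filter_upwards [ENNReal.tendsto_nhds_zero.1 hlim η (by exact_mod_cast hη)] with n hn
    constructor
    · refine (outerExp_le_add_of_forall_notMem_le k hC fun ω hω => ?_).trans (by gcongr)
      exact (not_not.1 hω).1
    · refine (outerExp_le_add_of_forall_notMem_le k hC fun ω hω => ?_).trans (by gcongr)
      exact (not_not.1 hω).2
  have hfin := (k.lintegral_lt_top_of_nnreal Q).ne
  rw [ENNReal.tendsto_nhds hfin]
  intro ε hε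
  obtain ⟨η, hη, hηε⟩ : ∃ η : ℝ≥0, 0 < η ∧ (η : ℝ≥0∞) + (η + η) ≤ ε := by
    obtain ⟨η, hη, hlt⟩ := ENNReal.lt_iff_exists_nnreal_btwn.1
      (ENNReal.div_pos hε.ne' (by simp : (3 : ℝ≥0∞) ≠ ∞))
    refine ⟨η, by exact_mod_cast hη, ?_⟩
    calc (η : ℝ≥0∞) + (η + η) = 3 * η := by ring
      _ ≤ 3 * (ε / 3) := by gcongr
      _ = ε := ENNReal.mul_div_cancel (by simp) (by simp)
  filter_upwards [hCtop η hη, (ENNReal.tendsto_nhds hfin).1 (hY.2 k) η (by exact_mod_cast hη)]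
    with n hn hI
  refine ⟨?_, ?_⟩
  · rw [tsub_le_iff_right]
    refine (tsub_le_iff_right.1 hI.1).trans ((add_le_add_left hn.2 _).trans ?_)
    rw [add_assoc, add_comm ((η : ℝ≥0∞) + η)]
    gcongr
  · refine hn.1.trans ((add_le_add_left hI.2 _).trans ?_)
    rw [add_assoc]
    gcongr

end WeakConvergence

/-! ### The Gaussian limit of an empirical process -/

section GaussianLimit

theorem Linf.continuous_eval {ι : Type*} (i : ι) : Continuous fun x : Linf ι => x i := by
  refine (LipschitzWith.of_dist_le_mul (K := 1) fun x y => ?_).continuous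
  rw [dist_eq_norm, dist_eq_norm, NNReal.coe_one, one_mul]
  exact lp.norm_apply_le_norm ENNReal.top_ne_zero (x - y) i

variable {S Ω : Type*} [MeasurableSpace S] [MeasurableSpace Ω] {μ : Measure Ω}
  [IsProbabilityMeasure μ] {P : Measure S} {Z : ℕ → Ω → S}

theorem measurable_sample (hZ : ∀ i, Measurable (Z i)) (n : ℕ) :
    Measurable fun ω (j : Fin n) => Z j ω :=
  measurable_pi_lambda _ fun j => hZ j

theorem map_sample_eq_pi (hZ : ∀ i, Measurable (Z i)) (hP : ∀ i, μ.map (Z i) = P)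
    (hind : iIndepFun Z μ) (n : ℕ) :
    μ.map (fun ω (j : Fin n) => Z j ω) = Measure.pi fun _ : Fin n => P := by
  have h := (iIndepFun_iff_map_fun_eq_pi_map (μ := μ) (f := fun j : Fin n => Z j)
    fun j => (hZ j).aemeasurable).1 (hind.precomp Fin.val_injective)
  simpa only [hP] using h

theorem empiricalProcess_apply {ι : Type*} {F : ι → S → ℝ} (hb : PointwiseBounded P F)
    (n : ℕ) (z : ℕ → S) (i : ι) :
    (empiricalProcess hb n fun j : Fin n => z j) i =
      (Real.sqrt n)⁻¹ * (∑ j ∈ Finset.range n, F i (z j) - n * ∫ y, F i y ∂P) := by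
  change (Real.sqrt n)⁻¹ * ∑ j : Fin n, (F i (z j) - ∫ y, F i y ∂P) = _
  rw [Fin.sum_univ_eq_sum_range fun j => F i (z j) - ∫ y, F i y ∂P, Finset.sum_sub_distrib]
  simp

/-- The central limit theorem for a sample from `P`, in terms of nonnegative test functions. -/
theorem tendsto_lintegral_centred_sum (hZ : ∀ i, Measurable (Z i)) (hP : ∀ i, μ.map (Z i) = P)
    (hind : iIndepFun Z μ) {g : S → ℝ} (hg : MemLp g 2 P) (k : ℝ →ᵇ ℝ≥0) :
    Tendsto (fun n : ℕ => ∫⁻ ω, (k ((Real.sqrt n)⁻¹ *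
        (∑ j ∈ Finset.range n, g (Z j ω) - n * ∫ z, g z ∂P)) : ℝ≥0∞) ∂μ) atTop
      (𝓝 (∫⁻ x, (k x : ℝ≥0∞) ∂gaussianReal 0 Var[g; P].toNNReal)) := by
  have hgm : ∀ i, AEMeasurable g (μ.map (Z i)) := fun i => by
    rw [hP i]
    exact hg.aestronglyMeasurable.aemeasurable
  have hident : ∀ i, IdentDistrib (fun ω => g (Z i ω)) (fun ω => g (Z 0 ω)) μ μ := fun i =>
    IdentDistrib.comp_of_aemeasurable (u := g)
      ⟨(hZ i).aemeasurable, (hZ 0).aemeasurable, by rw [hP i, hP 0]⟩ (hgm i)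
  have hmem : MemLp (fun ω => g (Z 0 ω)) 2 μ :=
    MemLp.comp_of_map (f := Z 0) (by rwa [hP 0]) (hZ 0).aemeasurable
  have hvar : Var[fun ω => g (Z 0 ω); μ] = Var[g; P] := by
    rw [← hP 0, variance_map (hgm 0) (hZ 0).aemeasurable]
    rfl
  have hmean : ∫ ω, g (Z 0 ω) ∂μ = ∫ z, g z ∂P := by
    rw [← hP 0, integral_map (hZ 0).aemeasurable (hgm 0).aestronglyMeasurable]
  have hclt := tendstoInDistribution_inv_sqrt_mul_sum_sub (P := μ)
    (X := fun i ω => g (Z i ω)) (Y := id) (P' := gaussianReal 0 Var[fun ω => g (Z 0 ω); μ].toNNReal)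
    HasLaw.id hmem (hind.comp₀ (fun _ => g) (fun i => (hZ i).aemeasurable) hgm) hident
  have h := ProbabilityMeasure.tendsto_iff_forall_lintegral_tendsto.1 hclt.tendsto k
  simp only [ProbabilityMeasure.coe_mk, Measure.map_id] at h
  rw [hvar] at h
  refine h.congr fun n => ?_
  rw [lintegral_map' (by fun_prop) (hclt.forall_aemeasurable n)]
  simp only [hmean]

/-- The finite-dimensional laws of the limit of an empirical process are given by the central limit
theorem. -/
theorem map_sum_eq_gaussianReal (hZ : ∀ i, Measurable (Z i)) (hP : ∀ i, μ.map (Z i) = P)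
    (hind : iIndepFun Z μ) {ι : Type*} {F : ι → S → ℝ} (hF : ∀ i, MemLp (F i) 2 P)
    (hb : PointwiseBounded P F) {Q : Measure (Linf ι)}
    (hQ : WeakConv (fun _ => μ) (fun n ω => empiricalProcess hb n fun j : Fin n => Z j ω) Q)
    {κ : Type*} [Fintype κ] (e : κ → ι) (t : κ → ℝ) :
    Q.map (fun x => ∑ m, t m * x (e m)) =
      gaussianReal 0 Var[fun z => ∑ m, t m * F (e m) z; P].toNNReal := by
  have := hQ.1
  have hPprob : IsProbabilityMeasure P := by
    rw [← hP 0]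
    exact Measure.isProbabilityMeasure_map (hZ 0).aemeasurable
  have hT : Continuous fun x : Linf ι => ∑ m, t m * x (e m) :=
    continuous_finsetSum _ fun m _ => continuous_const.mul (Linf.continuous_eval (e m))
  have := Measure.isProbabilityMeasure_map (μ := Q) hT.measurable.aemeasurable
  have hg : MemLp (fun z => ∑ m, t m * F (e m) z) 2 P :=
    memLp_finsetSum _ fun m _ => (hF (e m)).const_mul (t m)
  refine ext_of_forall_lintegral_eq_of_IsFiniteMeasure fun k => ?_
  refine tendsto_nhds_unique ((hQ.map hT).2 k) ?_
  refine (tendsto_lintegral_centred_sum hZ hP hind hg k).congr fun n => ?_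
  have hval : ∀ ω, ∑ m, t m * (empiricalProcess hb n fun j : Fin n => Z j ω) (e m) =
      (Real.sqrt n)⁻¹ * (∑ j ∈ Finset.range n, ∑ m, t m * F (e m) (Z j ω)
        - n * ∫ z, ∑ m, t m * F (e m) z ∂P) := by
    intro ω
    have hint : ∫ z, ∑ m, t m * F (e m) z ∂P = ∑ m, t m * ∫ z, F (e m) z ∂P := by
      rw [integral_finsetSum _ fun m _ => ((hF (e m)).integrable one_le_two).const_mul (t m)]
      simp only [integral_const_mul]
    rw [hint, Finset.sum_comm, Finset.mul_sum, ← Finset.sum_sub_distrib, Finset.mul_sum]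
    refine Finset.sum_congr rfl fun m _ => ?_
    rw [empiricalProcess_apply hb n fun j => Z j ω, ← Finset.mul_sum]
    ring
  simp only [hval]
  refine (outerExp_eq_lintegral ?_).symm
  have hgm : ∀ j, AEMeasurable (fun ω => ∑ m, t m * F (e m) (Z j ω)) μ := fun j => by
    have h := hg.aestronglyMeasurable.aemeasurable
    rw [← hP j] at h
    exact h.comp_measurable (hZ j)
  have hk : Measurable fun x : ℝ => (k x : ℝ≥0∞) := by fun_prop
  exact hk.comp_aemeasurable
    (((Finset.aemeasurable_fun_sum _ fun j _ => hgm j).sub_const _).const_mul _)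

theorem integral_add_sq_eq {α : Type*} [MeasurableSpace α] {ν : Measure α} {u v : α → ℝ}
    (hu : MemLp u 2 ν) (hv : MemLp v 2 ν) :
    ∫ x, (u x + v x) ^ 2 ∂ν = ∫ x, u x ^ 2 ∂ν + 2 * ∫ x, u x * v x ∂ν + ∫ x, v x ^ 2 ∂ν := by
  have huv : Integrable (fun x => 2 * (u x * v x)) ν := (hu.integrable_mul hv).const_mul 2
  have hsum : Integrable (fun x => u x ^ 2 + 2 * (u x * v x)) ν := hu.integrable_sq.add huv
  have hexp : ∀ x, (u x + v x) ^ 2 = u x ^ 2 + 2 * (u x * v x) + v x ^ 2 := fun x => by ring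
  simp only [hexp]
  rw [integral_add hsum hv.integrable_sq, integral_add hu.integrable_sq huv, integral_const_mul]

/-- The limit of the empirical process of a centred Donsker class is the tight mean zero Gaussian
process with the covariance of the class. -/
theorem isTightGaussianLaw_of_weakConv (hZ : ∀ i, Measurable (Z i)) (hP : ∀ i, μ.map (Z i) = P)
    (hind : iIndepFun Z μ) {ι : Type*} {F : ι → S → ℝ} (hF : ∀ i, MemLp (F i) 2 P)
    (hF0 : ∀ i, ∫ z, F i z ∂P = 0) (hb : PointwiseBounded P F) {Q : Measure (Linf ι)}
    (hQt : IsTightMeasureSet {Q})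
    (hQ : WeakConv (fun _ => μ) (fun n ω => empiricalProcess hb n fun j : Fin n => Z j ω) Q) :
    IsTightGaussianLaw (fun i j => ∫ z, F i z * F j z ∂P) Q := by
  classical
  have hQprob := hQ.1
  have hPprob : IsProbabilityMeasure P := by
    rw [← hP 0]
    exact Measure.isProbabilityMeasure_map (hZ 0).aemeasurable
  have heval : ∀ i, Measurable fun x : Linf ι => x i := fun i =>
    (Linf.continuous_eval i).measurable
  -- first two moments of linear combinations
  have hmom : ∀ {κ : Type} [Fintype κ] (e : κ → ι) (t : κ → ℝ),
      MemLp (fun x : Linf ι => ∑ m, t m * x (e m)) 2 Q ∧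
      ∫ x, ∑ m, t m * x (e m) ∂Q = 0 ∧
      ∫ x, (∑ m, t m * x (e m)) ^ 2 ∂Q = ∫ z, (∑ m, t m * F (e m) z) ^ 2 ∂P := by
    intro κ _ e t
    have hT : Measurable fun x : Linf ι => ∑ m, t m * x (e m) :=
      Finset.measurable_fun_sum _ fun m _ => (heval (e m)).const_mul (t m)
    have hlaw := map_sum_eq_gaussianReal hZ hP hind hF hb hQ e t
    have hmem : MemLp (fun x : Linf ι => ∑ m, t m * x (e m)) 2 Q := by
      have hid : MemLp id 2 (Q.map fun x => ∑ m, t m * x (e m)) := by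
        rw [hlaw]
        exact memLp_id_gaussianReal' 2 (by simp)
      exact hid.comp_of_map hT.aemeasurable
    have hmean : ∫ x, ∑ m, t m * x (e m) ∂Q = 0 := by
      rw [← integral_map (f := fun y : ℝ => y) hT.aemeasurable (by fun_prop), hlaw,
        integral_id_gaussianReal]
    refine ⟨hmem, hmean, ?_⟩
    have hg : MemLp (fun z => ∑ m, t m * F (e m) z) 2 P :=
      memLp_finsetSum _ fun m _ => (hF (e m)).const_mul (t m)
    have hg0 : ∫ z, ∑ m, t m * F (e m) z ∂P = 0 := by
      rw [integral_finsetSum _ fun m _ => ((hF (e m)).integrable one_le_two).const_mul (t m)]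
      simp [integral_const_mul, hF0]
    rw [← variance_of_integral_eq_zero hT.aemeasurable hmean,
      ← variance_of_integral_eq_zero hg.aestronglyMeasurable.aemeasurable hg0]
    have hv := variance_map (X := id) (μ := Q) (Y := fun x : Linf ι => ∑ m, t m * x (e m))
      aemeasurable_id hT.aemeasurable
    rw [hlaw, variance_id_gaussianReal] at hv
    rw [← Function.id_comp (fun x : Linf ι => ∑ m, t m * x (e m)), ← hv,
      Real.coe_toNNReal _ (variance_nonneg _ _)]
  have hone : ∀ i, MemLp (fun x : Linf ι => x i) 2 Q ∧ ∫ x, x i ∂Q = 0 ∧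
      ∫ x, x i ^ 2 ∂Q = ∫ z, F i z ^ 2 ∂P := fun i => by
    simpa using hmom (fun _ : Unit => i) fun _ => 1
  have htwo : ∀ i j, ∫ x, (x i + x j) ^ 2 ∂Q = ∫ z, (F i z + F j z) ^ 2 ∂P := fun i j => by
    simpa using (hmom (fun m : Fin 2 => if m = 0 then i else j) fun _ => 1).2.2
  refine ⟨hQprob, hQt, ⟨fun I => ⟨?_⟩⟩, fun i => (hone i).2.1, fun i j => ?_⟩
  · have hres : Measurable fun x : Linf ι => I.restrict fun i => x i :=
      measurable_pi_lambda _ fun i => heval i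
    refine isGaussian_of_map_eq_gaussianReal fun L => ⟨0, _, Eq.trans ?_
      (map_sum_eq_gaussianReal hZ hP hind hF hb hQ (fun i : I => (i : ι))
        fun i => L (Pi.single i 1))⟩
    rw [Measure.map_map L.continuous.measurable hres]
    congr 1
    ext x
    have hsum : (I.restrict fun i => x i) = ∑ i : I, x i • Pi.single i (1 : ℝ) := by
      ext i
      simp [Finset.sum_apply, Pi.single_apply]
    rw [Function.comp_apply, hsum, map_sum]
    simp [mul_comm]
  -- covariances by polarization
  · have h1 := integral_add_sq_eq (hone i).1 (hone j).1
    have h2 := integral_add_sq_eq (hF i) (hF j)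
    have h3 := htwo i j
    rw [(hone i).2.2, (hone j).2.2] at h1
    linarith

/-- A Donsker class is Glivenko–Cantelli, in outer probability. -/
theorem IsDonsker.eventually_abs_average_sub_le (hZ : ∀ i, Measurable (Z i))
    (hP : ∀ i, μ.map (Z i) = P) (hind : iIndepFun Z μ) {ι : Type*} {F : ι → S → ℝ}
    (hF : IsDonsker P F) {ε : ℝ} (hε : 0 < ε) :
    ∀ᶠ p in withHighProb μ, ∀ i,
      |1 / (p.1 : ℝ) * ∑ j ∈ Finset.range p.1, F i (Z j p.2) - ∫ z, F i z ∂P| ≤ ε := by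
  obtain ⟨-, hb, Q, -, hQ⟩ := hF
  refine (hQ.comp_sample (measurable_sample hZ) (map_sample_eq_pi hZ hP hind)).bigOP_norm.eventually
    fun C => ?_
  have hsqrt : Tendsto (fun n : ℕ => ε * Real.sqrt n) atTop atTop :=
    (Real.tendsto_sqrt_atTop.comp tendsto_natCast_atTop_atTop).const_mul_atTop hε
  filter_upwards [tendsto_fst_withHighProb.eventually (hsqrt.eventually_ge_atTop C),
    tendsto_fst_withHighProb.eventually (eventually_gt_atTop 0)] with p hp hn hW i
  have hn' : (0 : ℝ) < p.1 := Nat.cast_pos.2 hn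
  have hs : 0 < Real.sqrt p.1 := Real.sqrt_pos.2 hn'
  have hWi := (lp.norm_apply_le_norm ENNReal.top_ne_zero
    (empiricalProcess hb p.1 fun j : Fin p.1 => Z j p.2) i).trans ((le_abs_self _).trans hW)
  rw [Real.norm_eq_abs, empiricalProcess_apply hb p.1 fun j => Z j p.2] at hWi
  have heq : 1 / (p.1 : ℝ) * ∑ j ∈ Finset.range p.1, F i (Z j p.2) - ∫ z, F i z ∂P =
      ((Real.sqrt p.1)⁻¹ * (∑ j ∈ Finset.range p.1, F i (Z j p.2) - p.1 * ∫ z, F i z ∂P))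
        / Real.sqrt p.1 := by
    have := Real.mul_self_sqrt hn'.le
    field_simp
    rw [sq, this]
    field_simp
  rw [heq, abs_div, abs_of_pos hs, div_le_iff₀ hs]
  exact hWi.trans hp

end GaussianLimit

/-! ### Calculus on an interval, with one-sided derivatives at endpoints -/

section Calculus

variable {B : Set ℝ} {u u' u'' v v' v'' : ℝ → ℝ}

/-- The mean value theorem, with the endpoints in either order. -/
theorem exists_mem_uIcc_slope (hB : B.OrdConnected)
    (hu : ∀ t ∈ B, HasDerivWithinAt u (u' t) B t) {x y : ℝ} (hx : x ∈ B) (hy : y ∈ B)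
    (hne : x ≠ y) : ∃ ξ ∈ uIcc x y, ξ ≠ x ∧ u y - u x = u' ξ * (y - x) := by
  have key : ∀ {a b : ℝ}, a ∈ B → b ∈ B → a < b →
      ∃ ξ ∈ Ioo a b, u b - u a = u' ξ * (b - a) := by
    intro a b ha hb hab
    have hsub : Icc a b ⊆ B := hB.out ha hb
    obtain ⟨ξ, hξ, h⟩ := exists_hasDerivAt_eq_slope u u' hab
      (fun t ht => ((hu t (hsub ht)).continuousWithinAt).mono hsub)
      fun t ht => (hu t (hsub (Ioo_subset_Icc_self ht))).hasDerivAt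
        (mem_of_superset (Icc_mem_nhds ht.1 ht.2) hsub)
    refine ⟨ξ, hξ, ?_⟩
    rw [h, div_mul_cancel₀ _ (sub_ne_zero.2 hab.ne')]
  rcases lt_or_gt_of_ne hne with h | h
  · obtain ⟨ξ, hξ, e⟩ := key hx hy h
    exact ⟨ξ, by rw [uIcc_of_le h.le]; exact Ioo_subset_Icc_self hξ, hξ.1.ne', e⟩
  · obtain ⟨ξ, hξ, e⟩ := key hy hx h
    exact ⟨ξ, by rw [uIcc_of_ge h.le]; exact Ioo_subset_Icc_self hξ, hξ.2.ne, by linarith⟩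

theorem exists_mem_uIcc_taylor (hB : B.OrdConnected)
    (hu : ∀ t ∈ B, HasDerivWithinAt u (u' t) B t)
    (hu' : ∀ t ∈ B, HasDerivWithinAt u' (u'' t) B t) {x y : ℝ} (hx : x ∈ B) (hy : y ∈ B) :
    ∃ ξ ∈ uIcc x y, u y = u x + u' x * (y - x) + u'' ξ / 2 * (y - x) ^ 2 := by
  rcases eq_or_ne x y with rfl | hne
  · exact ⟨x, left_mem_uIcc, by simp⟩
  have hyx : y - x ≠ 0 := sub_ne_zero.2 hne.symm
  -- `K` is such that `w` takes the same value at `x` and `y`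
  obtain ⟨K, hK⟩ : ∃ K, K * (y - x) ^ 2 = u y - u x - u' x * (y - x) :=
    ⟨_, div_mul_cancel₀ _ (pow_ne_zero 2 hyx)⟩
  have hw : ∀ t ∈ B, HasDerivWithinAt (fun t => u t - u' x * (t - x) - K * (t - x) ^ 2)
      (u' t - u' x - K * (2 * (t - x))) B t := by
    intro t ht
    have h1 : HasDerivWithinAt (fun t => t - x) 1 B t := (hasDerivWithinAt_id t B).sub_const x
    have h2 := ((hu t ht).sub (h1.const_mul (u' x))).sub ((h1.pow 2).const_mul K)
    refine h2.congr_deriv ?_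
    push_cast
    ring
  obtain ⟨ξ₁, hξ₁, hξ₁x, h1⟩ := exists_mem_uIcc_slope hB hw hx hy hne
  have h1' : u' ξ₁ - u' x - K * (2 * (ξ₁ - x)) = 0 := by
    refine (mul_eq_zero.1 (h1.symm.trans ?_)).resolve_right hyx
    linear_combination -hK
  have hξ₁B : ξ₁ ∈ B := hB.uIcc_subset hx hy hξ₁
  obtain ⟨ξ, hξ, _, h2⟩ := exists_mem_uIcc_slope hB hu' hx hξ₁B hξ₁x.symm
  refine ⟨ξ, uIcc_subset_uIcc_left hξ₁ hξ, ?_⟩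
  have h3 : u'' ξ = 2 * K :=
    mul_right_cancel₀ (sub_ne_zero.2 hξ₁x) (by linear_combination -h2 + h1')
  rw [h3]
  linear_combination -hK

/-- Landau's inequality: bounds on a function and its second derivative bound the first
derivative, on an interval that may be unbounded. -/
theorem abs_deriv_le_of_abs_le (hB : B.OrdConnected)
    (hu : ∀ t ∈ B, HasDerivWithinAt u (u' t) B t)
    (hu' : ∀ t ∈ B, HasDerivWithinAt u' (u'' t) B t) {r ε : ℝ} (hr : 0 < r) (hrB : r ∈ B)
    (hrB' : -r ∈ B) (h0 : ∀ t ∈ B, |u t| ≤ ε) (h2 : ∀ t ∈ B, |u'' t| ≤ ε) {t : ℝ} (ht : t ∈ B) :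
    |u' t| ≤ (2 / r + r / 2) * ε := by
  -- a step of length `r` towards the origin
  obtain ⟨s, hs, hts⟩ : ∃ s : ℝ, |s| = r ∧ t + s ∈ B := by
    rcases le_total 0 t with h | h
    · exact ⟨-r, by rw [abs_neg, abs_of_pos hr], hB.out hrB' ht ⟨by linarith, by linarith⟩⟩
    · exact ⟨r, abs_of_pos hr, hB.out ht hrB ⟨by linarith, by linarith⟩⟩
  obtain ⟨ξ, hξ, h⟩ := exists_mem_uIcc_taylor hB hu hu' ht hts
  have hξB := hB.uIcc_subset ht hts hξ
  have hprod : u' t * s = u (t + s) - u t - u'' ξ / 2 * r ^ 2 := by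
    rw [← hs, sq_abs]
    linear_combination -h
  have hbound : |u' t| * r ≤ ε + ε + ε / 2 * r ^ 2 := by
    rw [← hs, ← abs_mul, hprod, hs]
    refine (abs_sub _ _).trans
      (add_le_add ((abs_sub _ _).trans (add_le_add (h0 _ hts) (h0 _ ht))) ?_)
    rw [abs_mul, abs_div, abs_of_pos (by positivity : (0 : ℝ) < r ^ 2), abs_two]
    gcongr
    exact h2 ξ hξB
  rw [← le_div_iff₀ hr] at hbound
  refine hbound.trans (le_of_eq ?_)
  field_simp
  ring

/-- A point where the derivative of a convex function, strongly convex near its minimizer `0`, is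
small, is close to `0`. -/
theorem abs_le_of_abs_deriv_lt (hB : B.OrdConnected) (hmono : MonotoneOn v' B)
    (hv' : ∀ t ∈ B, HasDerivWithinAt v' (v'' t) B t) (h0 : v' 0 = 0) {c δ : ℝ} (hδ : 0 < δ)
    (hδB : δ ∈ B) (hδB' : -δ ∈ B) (hc : ∀ t ∈ B, |t| ≤ δ → c ≤ v'' t) {t : ℝ} (ht : t ∈ B)
    (hlt : |v' t| < c * δ) : |t| ≤ δ := by
  have h0B : (0 : ℝ) ∈ B := hB.out hδB' hδB ⟨by linarith, hδ.le⟩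
  rw [abs_lt] at hlt
  rw [abs_le]
  constructor
  · by_contra! hcon
    obtain ⟨ξ, hξ, -, h⟩ := exists_mem_uIcc_slope hB hv' h0B hδB' (by linarith)
    rw [uIcc_of_ge (by linarith)] at hξ
    have h1 := hc ξ (hB.out hδB' h0B hξ) (abs_le.2 ⟨hξ.1, hξ.2.trans hδ.le⟩)
    have h2 := hmono ht hδB' hcon.le
    nlinarith
  · by_contra! hcon
    obtain ⟨ξ, hξ, -, h⟩ := exists_mem_uIcc_slope hB hv' h0B hδB (by linarith)
    rw [uIcc_of_le hδ.le] at hξ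
    have h1 := hc ξ (hB.out h0B hδB hξ) (abs_le.2 ⟨by linarith [hξ.1], hξ.2⟩)
    have h2 := hmono hδB ht hcon.le
    nlinarith

/-- The drop of a nearly quadratic function from `0` to a nearly stationary point `b`, rescaled by
`m ^ 2`. The curvature `a` is not bounded above, so errors in it enter relative to `a`. -/
theorem abs_scaled_drop_sub_le (hB : B.OrdConnected)
    (hu : ∀ t ∈ B, HasDerivWithinAt u (u' t) B t)
    (hu' : ∀ t ∈ B, HasDerivWithinAt u' (u'' t) B t) {a b c m η R : ℝ} (h0 : 0 ∈ B) (hb : b ∈ B)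
    (hc : 0 < c) (hca : c ≤ a) (hη0 : 0 ≤ η) (hη1 : η ≤ 1) (hηc : 2 * η ≤ c)
    (hcurv : ∀ t ∈ B, |t| ≤ |b| → |u'' t - a| ≤ η) (hstat : |m * u' b| ≤ η)
    (hR : |m * u' 0| ≤ R) :
    |m ^ 2 * (u 0 - u b) - (m * u' 0) ^ 2 / (2 * a)| ≤
      η * ((R + 1) * 2 / c ^ 2 + 2 * ((R + 1) * 2 / c) ^ 2 + 1 / c) := by
  have ha : 0 < a := hc.trans_le hca
  have hle : ∀ ξ ∈ uIcc b 0, ξ ∈ B ∧ |ξ| ≤ |b| := fun ξ hξ =>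
    ⟨hB.uIcc_subset hb h0 hξ, by simpa [abs_sub_comm] using abs_sub_right_of_mem_uIcc hξ⟩
  -- `a₁` is the mean curvature in the expansion of `u'`, `a₂` the one in the expansion of `u`
  obtain ⟨a₁, ha₁, h1⟩ : ∃ a₁, |a₁ - a| ≤ η ∧ u' 0 - u' b = a₁ * (0 - b) := by
    rcases eq_or_ne b 0 with rfl | hne
    · exact ⟨a, by simpa using hη0, by simp⟩
    · obtain ⟨ξ, hξ, -, h⟩ := exists_mem_uIcc_slope hB hu' hb h0 hne
      exact ⟨u'' ξ, hcurv ξ (hle ξ hξ).1 (hle ξ hξ).2, h⟩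
  obtain ⟨a₂, ha₂, h2⟩ : ∃ a₂, |a₂ - a| ≤ η ∧
      u 0 = u b + u' b * (0 - b) + a₂ / 2 * (0 - b) ^ 2 := by
    obtain ⟨ξ, hξ, h⟩ := exists_mem_uIcc_taylor hB hu hu' hb h0
    exact ⟨u'' ξ, hcurv ξ (hle ξ hξ).1 (hle ξ hξ).2, h⟩
  set y := m * b with hy
  set q := m * u' b with hq
  set p := m * u' 0 with hp
  have hpq : p = q - a₁ * y := by rw [hp, hq, hy]; linear_combination m * h1
  have hdrop : m ^ 2 * (u 0 - u b) = -q * y + a₂ / 2 * y ^ 2 := by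
    rw [hq, hy, h2]; ring
  rw [abs_le] at ha₁ ha₂
  have hyb : |y| ≤ (R + 1) * 2 / c := by
    have h3 : |a₁ * y| ≤ R + 1 := by
      rw [show a₁ * y = q - p by rw [hpq]; ring]
      exact (abs_sub _ _).trans (by linarith)
    rw [abs_mul, abs_of_pos (by linarith : 0 < a₁)] at h3
    rw [le_div_iff₀ hc]
    nlinarith [abs_nonneg y]
  have hid : m ^ 2 * (u 0 - u b) - p ^ 2 / (2 * a) =
      q * y * ((a₁ - a) / a) + y ^ 2 / 2 * ((a₂ - a) - (a₁ - a) * (2 + (a₁ - a) / a))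
        - q ^ 2 / (2 * a) := by
    rw [hdrop, hpq]
    field_simp
    ring
  have hrel : |(a₁ - a) / a| ≤ η / c := by
    rw [abs_div, abs_of_pos ha]
    exact div_le_div₀ hη0 (abs_le.2 ha₁) hc hca
  have hrel1 : |2 + (a₁ - a) / a| ≤ 3 := by
    have h4 : η / c ≤ 1 := by rw [div_le_one hc]; linarith
    rw [abs_le] at hrel ⊢
    constructor <;> linarith
  have t1 : |q * y * ((a₁ - a) / a)| ≤ 1 * ((R + 1) * 2 / c) * (η / c) := by
    rw [abs_mul, abs_mul]
    exact mul_le_mul (mul_le_mul (hstat.trans hη1) hyb (abs_nonneg _) zero_le_one) hrel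
      (abs_nonneg _) (mul_nonneg zero_le_one ((abs_nonneg y).trans hyb))
  have t2 : |y ^ 2 / 2 * ((a₂ - a) - (a₁ - a) * (2 + (a₁ - a) / a))| ≤
      ((R + 1) * 2 / c) ^ 2 / 2 * (η + η * 3) := by
    rw [abs_mul, abs_of_nonneg (by positivity : 0 ≤ y ^ 2 / 2), ← sq_abs y]
    refine mul_le_mul (by gcongr) ((abs_sub _ _).trans (add_le_add (abs_le.2 ha₂) ?_))
      (abs_nonneg _) (by positivity)
    rw [abs_mul]
    exact mul_le_mul (abs_le.2 ha₁) hrel1 (abs_nonneg _) hη0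
  have t3 : |q ^ 2 / (2 * a)| ≤ η / c := by
    rw [abs_div, abs_of_pos (by positivity : 0 < 2 * a), abs_pow]
    refine div_le_div₀ hη0 ?_ hc (by linarith)
    nlinarith [abs_nonneg q]
  rw [hid]
  calc _ ≤ 1 * ((R + 1) * 2 / c) * (η / c) + ((R + 1) * 2 / c) ^ 2 / 2 * (η + η * 3) + η / c :=
        (abs_sub _ _).trans (add_le_add ((abs_add_le _ _).trans (add_le_add t1 t2)) t3)
    _ = _ := by
        field_simp
        ring

end Calculus

/-! ### Suprema of squared standardized processes -/

section QuadraticSup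

variable {ι : Type*} {a : ι → ℝ} {c : ℝ}

theorem sq_rpow_neg_half_mul {a : ℝ} (ha : 0 < a) (x : ℝ) :
    ((2 * a) ^ (-(1 / 2) : ℝ) * x) ^ 2 = x ^ 2 / (2 * a) := by
  have h2a : 0 < 2 * a := by positivity
  have h : ((2 * a) ^ (-(1 / 2) : ℝ)) ^ 2 = (2 * a)⁻¹ := by
    rw [← Real.rpow_natCast, ← Real.rpow_mul h2a.le, ← Real.rpow_neg_one]
    norm_num
  rw [mul_pow, h]
  ring

theorem Linf.abs_apply_le (x : Linf ι) (i : ι) : |x i| ≤ ‖x‖ :=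
  lp.norm_apply_le_norm ENNReal.top_ne_zero x i

theorem bddAbove_range_sq_div (hc : 0 < c) (hca : ∀ i, c ≤ a i) (x : Linf ι) :
    BddAbove (range fun i => x i ^ 2 / (2 * a i)) := by
  refine ⟨‖x‖ ^ 2 / (2 * c), ?_⟩
  rintro _ ⟨i, rfl⟩
  have h1 := sq_le_sq' (neg_le_of_abs_le (Linf.abs_apply_le x i))
    (le_of_abs_le (Linf.abs_apply_le x i))
  have h2 := hca i
  dsimp only
  gcongr

/-- Functions that are uniformly close have close suprema, and both suprema are finite if one
is. -/
theorem abs_ciSup_sub_ciSup_le [Nonempty ι] {x y : ι → ℝ} {ε : ℝ} (hy : BddAbove (range y))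
    (h : ∀ i, |x i - y i| ≤ ε) : BddAbove (range x) ∧ |(⨆ i, x i) - ⨆ i, y i| ≤ ε := by
  have hxy : ∀ i, x i ≤ (⨆ i, y i) + ε := fun i => by
    linarith [le_ciSup hy i, (abs_le.1 (h i)).2]
  have hx : BddAbove (range x) := ⟨_, by rintro _ ⟨i, rfl⟩; exact hxy i⟩
  refine ⟨hx, abs_le.2 ⟨?_, ?_⟩⟩
  · have : (⨆ i, y i) ≤ (⨆ i, x i) + ε := ciSup_le fun i => by
      linarith [le_ciSup hx i, (abs_le.1 (h i)).1]
    linarith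
  · linarith [ciSup_le hxy]

theorem continuous_iSup_sq_div [Nonempty ι] (hc : 0 < c) (hca : ∀ i, c ≤ a i) :
    Continuous fun x : Linf ι => ⨆ i, x i ^ 2 / (2 * a i) := by
  refine continuous_iff_continuousAt.2 fun x => tendsto_iff_dist_tendsto_zero.2 ?_
  have hlim : Tendsto (fun y : Linf ι => ‖y - x‖ * (‖y‖ + ‖x‖) / (2 * c)) (𝓝 x) (𝓝 0) := by
    have hcont : Continuous fun y : Linf ι => ‖y - x‖ * (‖y‖ + ‖x‖) / (2 * c) := by fun_prop
    simpa using hcont.tendsto x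
  refine squeeze_zero (fun _ => dist_nonneg) (fun y => ?_) hlim
  rw [Real.dist_eq]
  refine (abs_ciSup_sub_ciSup_le (bddAbove_range_sq_div hc hca x) fun i => ?_).2
  have ha := hc.trans_le (hca i)
  have hfac : y i ^ 2 / (2 * a i) - x i ^ 2 / (2 * a i) =
      (y - x) i * (y i + x i) / (2 * a i) := by
    change _ = (y i - x i) * (y i + x i) / (2 * a i)
    ring
  rw [hfac, abs_div, abs_mul, abs_of_pos (by positivity : 0 < 2 * a i)]
  have h1 := Linf.abs_apply_le (y - x) i
  have h2 := (abs_add_le (y i) (x i)).trans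
    (add_le_add (Linf.abs_apply_le y i) (Linf.abs_apply_le x i))
  have h3 := hca i
  gcongr

end QuadraticSup

/-! ### Consequences of the null hypothesis -/

namespace FitFramework

section Framework

variable {S : Type*} [MeasurableSpace S] {d : ℕ} (A : FitFramework S d) {P₀ : Measure S}
  {φ : A.F → ℝ → S → ℝ}

theorem exists_pos_mem_B : ∃ r : ℝ, 0 < r ∧ r ∈ A.B ∧ -r ∈ A.B := by
  obtain ⟨x, hx, hne⟩ := A.B_nontrivial.exists_ne 0
  rcases lt_or_gt_of_ne hne with h | h
  · exact ⟨-x, by linarith, A.B_symm x hx, by rwa [neg_neg]⟩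
  · exact ⟨x, h, hx, A.B_symm x hx⟩

theorem mem_B_of_abs_le {r t : ℝ} (hr : r ∈ A.B) (ht : |t| ≤ r) : t ∈ A.B :=
  A.B_interval.out (A.B_symm r hr) hr (abs_le.1 ht)

theorem zero_mem_B : (0 : ℝ) ∈ A.B := by
  obtain ⟨r, hr, hrB, -⟩ := A.exists_pos_mem_B
  exact A.mem_B_of_abs_le hrB (by simpa using hr.le)

theorem uniqueDiffOn_B : UniqueDiffOn ℝ A.B := by
  obtain ⟨r, hr, hrB, hrB'⟩ := A.exists_pos_mem_B
  refine uniqueDiffOn_convex A.B_interval.convex ⟨0, mem_interior_iff_mem_nhds.2 ?_⟩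
  exact mem_of_superset (Icc_mem_nhds (by linarith) hr) (A.B_interval.out hrB' hrB)

variable {A}

theorem TwiceDiff.hasDeriv {u : ℝ → ℝ} (hu : A.TwiceDiff u) {t : ℝ} (ht : t ∈ A.B) :
    HasDerivWithinAt u (A.D1 u t) A.B t :=
  (hu.1 t ht).hasDerivWithinAt

theorem TwiceDiff.hasDeriv_D1 {u : ℝ → ℝ} (hu : A.TwiceDiff u) {t : ℝ} (ht : t ∈ A.B) :
    HasDerivWithinAt (A.D1 u) (A.D2 u t) A.B t :=
  (hu.2 t ht).hasDerivWithinAt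

/-- Without improvement in fit, every one-dimensional sub-model is fitted best at `0`, and
quadratic growth makes this the only minimizer. -/
theorem GoodnessConditions.minimizer_eq_zero {b₀ : A.F → ℝ} (hG : A.GoodnessConditions P₀ b₀ φ)
    (hP₀ : P₀ ∈ A.M) (hnull : A.Psi P₀ = 0) : b₀ = fun _ => 0 := by
  have : Nonempty A.F := A.F_nonempty.to_subtype
  have hsub : ∀ f : A.F, A.Gsub P₀ f 0 = A.G P₀ (A.thR P₀) := fun f => by
    refine congrArg (A.G P₀) (funext fun o => ?_)
    simp [sub, A.g_zero]
  have hle : ∀ f : A.F, A.Gsub P₀ f 0 = A.Gsub P₀ f (b₀ f) := fun f => by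
    refine le_antisymm ?_ (hG.b₀_min f A.zero_mem_B)
    have h1 := A.th_min P₀ hP₀ _ (A.sub_mem P₀ hP₀ f.1 f.2 (b₀ f) (hG.b₀_mem f))
    have h2 : A.G P₀ (A.thR P₀) - A.G P₀ (A.th P₀) = 0 := hnull
    rw [hsub]
    refine le_trans ?_ h1
    linarith
  obtain ⟨C₁, C₂, hC₁, hC₂, h⟩ := hG.quadratic_growth
  funext f
  have h0 := h (fun _ => 0) 0 (fun _ => A.zero_mem_B) (by simp [hle]) hC₁ f
  simpa using h0

/-! ### Uniform stochastic expansions of the estimator -/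

theorem natCast_rpow_neg_half_le_one {n : ℕ} (hn : 0 < n) : (n : ℝ) ^ (-(1 / 2) : ℝ) ≤ 1 :=
  Real.rpow_le_one_of_one_le_of_nonpos (by exact_mod_cast hn) (by norm_num)

theorem abs_le_mul_rpow_neg_half_iff {n : ℕ} (hn : 0 < n) {x ε : ℝ} :
    |x| ≤ ε * (n : ℝ) ^ (-(1 / 2) : ℝ) ↔ |Real.sqrt n * x| ≤ ε := by
  have hs : 0 < Real.sqrt n := Real.sqrt_pos.2 (Nat.cast_pos.2 hn)
  rw [Real.rpow_neg (Nat.cast_nonneg n), ← Real.sqrt_eq_rpow, ← div_eq_mul_inv, le_div_iff₀ hs,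
    abs_mul, abs_of_pos hs, mul_comm]

variable {Ω : Type*} {Z : ℕ → Ω → S} {Gt : ℕ → Ω → A.F → ℝ → ℝ} {bt : ℕ → Ω → A.F → ℝ}

theorem D1_remainder (hφ : ∀ f z, A.TwiceDiff fun b => φ f b z)
    (hG : ∀ f, A.TwiceDiff (A.Gsub P₀ f)) (hGt : ∀ n ω f, A.TwiceDiff (Gt n ω f)) (n : ℕ) (ω : Ω)
    (f : A.F) {b : ℝ} (hb : b ∈ A.B) :
    A.D1 (A.remainder P₀ φ Z Gt n ω f) b = A.D1 (Gt n ω f) b - A.D1 (A.Gsub P₀ f) b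
      - 1 / (n : ℝ) * ∑ i ∈ Finset.range n, A.D1 (fun b => φ f b (Z i ω)) b := by
  have hsum : HasDerivWithinAt (fun b => ∑ i ∈ Finset.range n, φ f b (Z i ω))
      (∑ i ∈ Finset.range n, A.D1 (fun b => φ f b (Z i ω)) b) A.B b :=
    HasDerivWithinAt.fun_sum fun i _ => (hφ f (Z i ω)).hasDeriv hb
  exact ((((hGt n ω f).hasDeriv hb).sub ((hG f).hasDeriv hb)).sub
    (hsum.const_mul (1 / (n : ℝ)))).derivWithin (A.uniqueDiffOn_B b hb)

variable [MeasurableSpace Ω] {μ : Measure Ω}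

theorem eventually_abs_D2_sub_le (hGt : A.EstimatorConditions μ P₀ φ Z Gt) {ε : ℝ}
    (hε : 0 < ε) : ∀ᶠ p in withHighProb μ, ∀ f, ∀ b ∈ A.B,
      |A.D2 (Gt p.1 p.2 f) b - A.D2 (A.Gsub P₀ f) b| ≤ ε := by
  filter_upwards [hGt.second_deriv.eventually hε] with p hp f b hb
  simpa using hp (f, ⟨b, hb⟩)

theorem eventually_abs_sqrt_mul_D1_bt_le (hbt : A.IsApproxStationary μ Gt bt) {ε : ℝ}
    (hε : 0 < ε) :
    ∀ᶠ p in withHighProb μ, ∀ f, |Real.sqrt p.1 * A.D1 (Gt p.1 p.2 f) (bt p.1 p.2 f)| ≤ ε := by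
  filter_upwards [hbt.small.eventually hε, eventually_pos_withHighProb] with p h hn f
  exact (abs_le_mul_rpow_neg_half_iff hn).1 (h f)

variable [IsProbabilityMeasure μ]

theorem eventually_abs_sub_Gsub_le (hZ : ∀ i, Measurable (Z i)) (hP : ∀ i, μ.map (Z i) = P₀)
    (hind : iIndepFun Z μ) (hG : A.GoodnessConditions P₀ (fun _ => 0) φ)
    (hGt : A.EstimatorConditions μ P₀ φ Z Gt) {ε : ℝ} (hε : 0 < ε) :
    ∀ᶠ p in withHighProb μ, ∀ f, ∀ b ∈ A.B, |Gt p.1 p.2 f b - A.Gsub P₀ f b| ≤ ε := by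
  filter_upwards [hGt.linear.eventually (half_pos hε), eventually_pos_withHighProb,
    hG.donsker.eventually_abs_average_sub_le hZ hP hind (half_pos hε)] with p hlin hn havg f b hb
  have h1 := (hlin (f, ⟨b, hb⟩)).trans
    (mul_le_of_le_one_right (half_pos hε).le (natCast_rpow_neg_half_le_one hn))
  have h2 := havg (f, ⟨b, hb⟩)
  dsimp only [remainder] at h1 h2
  rw [(hG.eif f b hb).mean_zero, sub_zero] at h2
  have h3 := abs_add_le (Gt p.1 p.2 f b - A.Gsub P₀ f b
    - 1 / (p.1 : ℝ) * ∑ i ∈ Finset.range p.1, φ f b (Z i p.2))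
    (1 / (p.1 : ℝ) * ∑ i ∈ Finset.range p.1, φ f b (Z i p.2))
  rw [sub_add_cancel] at h3
  linarith

/-- Uniform consistency of the first derivative, by interpolation between the function and its
second derivative. -/
theorem eventually_abs_D1_sub_le (hZ : ∀ i, Measurable (Z i)) (hP : ∀ i, μ.map (Z i) = P₀)
    (hind : iIndepFun Z μ) (hG : A.GoodnessConditions P₀ (fun _ => 0) φ)
    (hGt : A.EstimatorConditions μ P₀ φ Z Gt) {ε : ℝ} (hε : 0 < ε) :
    ∀ᶠ p in withHighProb μ, ∀ f, ∀ b ∈ A.B,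
      |A.D1 (Gt p.1 p.2 f) b - A.D1 (A.Gsub P₀ f) b| ≤ ε := by
  obtain ⟨r, hr, hrB, hrB'⟩ := A.exists_pos_mem_B
  have hK : 0 < 2 / r + r / 2 := by positivity
  have hε' : 0 < ε / (2 / r + r / 2) := div_pos hε hK
  filter_upwards [eventually_abs_sub_Gsub_le hZ hP hind hG hGt hε',
    eventually_abs_D2_sub_le hGt hε'] with p h0 h2 f b hb
  have h := abs_deriv_le_of_abs_le A.B_interval
    (fun t ht => ((hGt.smooth p.1 p.2 f).hasDeriv ht).sub ((hG.smooth_G f).hasDeriv ht))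
    (fun t ht => ((hGt.smooth p.1 p.2 f).hasDeriv_D1 ht).sub ((hG.smooth_G f).hasDeriv_D1 ht))
    hr hrB hrB' (h0 f) (h2 f) hb
  rwa [mul_div_cancel₀ _ hK.ne'] at h

/-- The derivative of the influence function at the minimizer is centred. No domination is
assumed: the averages of the derivatives converge both to their mean and, by the expansion of the
derivative of the estimator, to zero. -/
theorem integral_D1_influence_eq_zero (hZ : ∀ i, Measurable (Z i)) (hP : ∀ i, μ.map (Z i) = P₀)
    (hind : iIndepFun Z μ) (hG : A.GoodnessConditions P₀ (fun _ => 0) φ)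
    (hGt : A.EstimatorConditions μ P₀ φ Z Gt) (f : A.F) :
    ∫ z, A.D1 (fun b => φ f b z) 0 ∂P₀ = 0 := by
  refine abs_eq_zero.1 (le_antisymm (le_of_forall_pos_le_add fun ε hε => ?_) (abs_nonneg _))
  have hε3 : 0 < ε / 3 := by positivity
  refine of_eventually_withHighProb (μ := μ) ?_
  filter_upwards [eventually_abs_D1_sub_le hZ hP hind hG hGt hε3, eventually_pos_withHighProb,
    hGt.linear_deriv.eventually hε3,
    hG.donsker_deriv.eventually_abs_average_sub_le hZ hP hind hε3] with p h1 hn hlin havg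
  have h1' := h1 f 0 A.zero_mem_B
  have h2 := (hlin (f, ⟨0, A.zero_mem_B⟩)).trans
    (mul_le_of_le_one_right hε3.le (natCast_rpow_neg_half_le_one hn))
  have h3 := havg f
  dsimp only at h2 h3
  rw [D1_remainder hG.smooth_φ hG.smooth_G hGt.smooth _ _ _ A.zero_mem_B] at h2
  rw [abs_le] at h1' h2 h3 ⊢
  constructor <;> linarith

theorem eventually_abs_sqrt_mul_D1_zero_sub_le (hZ : ∀ i, Measurable (Z i))
    (hP : ∀ i, μ.map (Z i) = P₀) (hind : iIndepFun Z μ)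
    (hG : A.GoodnessConditions P₀ (fun _ => 0) φ) (hGt : A.EstimatorConditions μ P₀ φ Z Gt)
    (hb : PointwiseBounded P₀ fun (f : A.F) z => A.D1 (fun b => φ f b z) 0) {ε : ℝ}
    (hε : 0 < ε) :
    ∀ᶠ p in withHighProb μ, ∀ f, |Real.sqrt p.1 * A.D1 (Gt p.1 p.2 f) 0
      - (empiricalProcess hb p.1 fun j : Fin p.1 => Z j p.2) f| ≤ ε := by
  filter_upwards [hGt.linear_deriv.eventually hε, eventually_pos_withHighProb] with p hlin hn f
  have hn' : (0 : ℝ) < p.1 := Nat.cast_pos.2 hn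
  have hs : 0 < Real.sqrt p.1 := Real.sqrt_pos.2 hn'
  have h := hlin (f, ⟨0, A.zero_mem_B⟩)
  dsimp only at h
  rw [D1_remainder hG.smooth_φ hG.smooth_G hGt.smooth _ _ _ A.zero_mem_B, hG.stationary f,
    abs_le_mul_rpow_neg_half_iff hn] at h
  rw [empiricalProcess_apply hb p.1 fun j => Z j p.2,
    integral_D1_influence_eq_zero hZ hP hind hG hGt f]
  refine le_of_eq_of_le (congrArg _ ?_) h
  have hinv : (Real.sqrt p.1)⁻¹ = Real.sqrt p.1 * (1 / (p.1 : ℝ)) := by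
    rw [inv_eq_iff_eq_inv, mul_inv, one_div, inv_inv, eq_comm, inv_mul_eq_iff_eq_mul₀ hs.ne',
      Real.mul_self_sqrt hn'.le]
  rw [hinv]
  ring

/-- Uniform consistency of the nearly stationary points. -/
theorem eventually_abs_bt_le (hZ : ∀ i, Measurable (Z i)) (hP : ∀ i, μ.map (Z i) = P₀)
    (hind : iIndepFun Z μ) (hG : A.GoodnessConditions P₀ (fun _ => 0) φ)
    (hGt : A.EstimatorConditions μ P₀ φ Z Gt) (hbt : A.IsApproxStationary μ Gt bt) {δ : ℝ}
    (hδ : 0 < δ) : ∀ᶠ p in withHighProb μ, ∀ f, |bt p.1 p.2 f| ≤ δ := by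
  obtain ⟨r, hr, hrB, -⟩ := A.exists_pos_mem_B
  obtain ⟨δ₁, c, hδ₁, hc, hcurv⟩ := hG.curvature_pos
  set δ' := min δ (min r δ₁) with hδ'
  have hδ'0 : 0 < δ' := by positivity
  have hδ'r : δ' ≤ r := (min_le_right _ _).trans (min_le_left _ _)
  have hδ'1 : δ' ≤ δ₁ := (min_le_right _ _).trans (min_le_right _ _)
  have hδ'B : δ' ∈ A.B := A.mem_B_of_abs_le hrB (by rwa [abs_of_pos hδ'0])
  have hε : 0 < c * δ' / 3 := by positivity
  filter_upwards [eventually_abs_D1_sub_le hZ hP hind hG hGt hε, eventually_pos_withHighProb,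
    hbt.small.eventually hε] with p h1 hn h2 f
  have hB := hbt.mem p.1 p.2 f
  refine (abs_le_of_abs_deriv_lt A.B_interval
    ((hG.convex f).monotoneOn_derivWithin (hG.smooth_G f).1)
    (fun t ht => (hG.smooth_G f).hasDeriv_D1 ht) (hG.stationary f) hδ'0 hδ'B (A.B_symm _ hδ'B)
    (fun t ht hle => hcurv f t ht (by simpa using hle.trans hδ'1)) hB ?_).trans (min_le_left _ _)
  have h1' := h1 f _ hB
  have h2' := (h2 f).trans (mul_le_of_le_one_right hε.le (natCast_rpow_neg_half_le_one hn))
  change |A.D1 (A.Gsub P₀ f) (bt p.1 p.2 f)| < c * δ'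
  rw [abs_le] at h1' h2'
  rw [abs_lt]
  constructor <;> nlinarith

/-- Uniformly in the direction, the rescaled drop of the estimator is asymptotically quadratic in
the empirical process of the derivatives of the influence functions. -/
theorem eventually_abs_drop_sub_le (hZ : ∀ i, Measurable (Z i)) (hP : ∀ i, μ.map (Z i) = P₀)
    (hind : iIndepFun Z μ) (hG : A.GoodnessConditions P₀ (fun _ => 0) φ)
    (hGt : A.EstimatorConditions μ P₀ φ Z Gt) (hbt : A.IsApproxStationary μ Gt bt)
    (hb : PointwiseBounded P₀ fun (f : A.F) z => A.D1 (fun b => φ f b z) 0)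
    (hW : BigOP μ (fun n ω => ‖(empiricalProcess hb n fun j : Fin n => Z j ω)‖) fun _ => 1)
    {ε : ℝ} (hε : 0 < ε) :
    ∀ᶠ p in withHighProb μ, ∀ f, |(p.1 : ℝ) * (Gt p.1 p.2 f 0 - Gt p.1 p.2 f (bt p.1 p.2 f))
      - (empiricalProcess hb p.1 fun j : Fin p.1 => Z j p.2) f ^ 2
        / (2 * A.D2 (A.Gsub P₀ f) 0)| ≤ ε := by
  obtain ⟨δ₁, c, hδ₁, hc, hcurv⟩ := hG.curvature_pos
  refine hW.eventually fun C => ?_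
  set R := |C| + 1 with hR
  set K := (R + 1) * 2 / c ^ 2 + 2 * ((R + 1) * 2 / c) ^ 2 + 1 / c with hK
  set L := (2 * |C| + 1) / (2 * c) with hL
  have hK0 : 0 < K := by positivity
  have hL0 : 0 < L := by positivity
  obtain ⟨η, hη0, hη1, hηc, hηε⟩ : ∃ η : ℝ, 0 < η ∧ η ≤ 1 ∧ 2 * η ≤ c ∧ η * (K + L) ≤ ε := by
    refine ⟨min 1 (min (c / 2) (ε / (K + L))), by positivity, min_le_left _ _, ?_, ?_⟩
    · linarith [(min_le_right 1 (min (c / 2) (ε / (K + L)))).trans (min_le_left _ _)]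
    · rw [← le_div_iff₀ (by positivity)]
      exact (min_le_right _ _).trans (min_le_right _ _)
  obtain ⟨δ, hδ, hcont⟩ := hG.curvature_cont (η / 2) (by positivity)
  filter_upwards [eventually_abs_D2_sub_le hGt (half_pos hη0),
    eventually_abs_bt_le hZ hP hind hG hGt hbt hδ,
    eventually_abs_sqrt_mul_D1_bt_le hbt hη0,
    eventually_abs_sqrt_mul_D1_zero_sub_le hZ hP hind hG hGt hb hη0] with p h2 hδp hst hw hC f
  have hca : c ≤ A.D2 (A.Gsub P₀ f) 0 := hcurv f 0 A.zero_mem_B (by simpa using hδ₁.le)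
  set a := A.D2 (A.Gsub P₀ f) 0 with ha_def
  have ha : 0 < a := hc.trans_le hca
  set w := (empiricalProcess hb p.1 fun j : Fin p.1 => Z j p.2) f with hw_def
  set x := Real.sqrt p.1 * A.D1 (Gt p.1 p.2 f) 0 with hx_def
  have hwC : |w| ≤ |C| := by
    refine (Linf.abs_apply_le _ f).trans ?_
    rw [abs_of_nonneg (norm_nonneg _)] at hC
    exact hC.trans (le_abs_self C)
  have hxw : |x - w| ≤ η := hw f
  have hxR : |x| ≤ R := by
    have := abs_add_le (x - w) w
    rw [sub_add_cancel] at this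
    linarith
  have hmain := abs_scaled_drop_sub_le A.B_interval
    (fun t ht => (hGt.smooth p.1 p.2 f).hasDeriv ht)
    (fun t ht => (hGt.smooth p.1 p.2 f).hasDeriv_D1 ht) A.zero_mem_B (hbt.mem p.1 p.2 f) hc hca
    hη0.le hη1 hηc (fun t ht hle => by
      have h3 := h2 f t ht
      have h4 := hcont f t ht (by simpa using hle.trans (hδp f))
      rw [abs_le] at h3 h4 ⊢
      constructor <;> linarith) (hst f) hxR
  rw [Real.sq_sqrt (Nat.cast_nonneg _)] at hmain
  have hsq : |x ^ 2 / (2 * a) - w ^ 2 / (2 * a)| ≤ η * L := by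
    rw [show x ^ 2 / (2 * a) - w ^ 2 / (2 * a) = (x - w) * ((x + w) / (2 * a)) by ring, abs_mul,
      abs_div, abs_of_pos (by positivity : 0 < 2 * a)]
    have h5 : |x + w| ≤ 2 * |C| + 1 := (abs_add_le x w).trans (by linarith)
    exact mul_le_mul hxw
      (div_le_div₀ (by positivity) h5 (by positivity) (by linarith)) (by positivity) hη0.le
  have htri := abs_add_le
    ((p.1 : ℝ) * (Gt p.1 p.2 f 0 - Gt p.1 p.2 f (bt p.1 p.2 f)) - x ^ 2 / (2 * a))
    (x ^ 2 / (2 * a) - w ^ 2 / (2 * a))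
  rw [sub_add_sub_cancel] at htri
  linarith

end Framework

end FitFramework

/-! ### The limit law of the improvement in fit -/

theorem theorem2 {S Ω : Type*} [MeasurableSpace S] [MeasurableSpace Ω] {d : ℕ} (hd : 0 < d)
    (A : FitFramework S d) (P₀ : Measure S) (hP₀ : P₀ ∈ A.M)
    (μ : Measure Ω) [IsProbabilityMeasure μ]
    (Z : ℕ → Ω → S) (hZ_meas : ∀ i, Measurable (Z i)) (hZ_law : ∀ i, μ.map (Z i) = P₀)
    (hZ_indep : iIndepFun Z μ)
    (b₀ : A.F → ℝ) (φ : A.F → ℝ → S → ℝ) (hG : A.GoodnessConditions P₀ b₀ φ)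
    (Gt : ℕ → Ω → A.F → ℝ → ℝ) (hGt : A.EstimatorConditions μ P₀ φ Z Gt)
    (bt : ℕ → Ω → A.F → ℝ) (hbt : A.IsApproxStationary μ Gt bt)
    (hnull : A.Psi P₀ = 0) :
    -- the supremum defining the estimator is finite with probability tending to one
    Tendsto (fun n => μ {ω | ¬ BddAbove (range fun f => Gt n ω f 0 - Gt n ω f (bt n ω f))})
        atTop (𝓝 0) ∧
    -- `n`-rate consistency
    BigOP μ (fun n ω => A.PsiEst Gt bt n ω - A.Psi P₀) (fun n => 1 / (n : ℝ)) ∧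
    -- the weak limit
    ∃ H : Measure (Linf A.F), IsTightGaussianLaw (A.limitCov P₀ b₀ φ) H ∧
      WeakConv (fun _ => μ) (fun n ω => (n : ℝ) * A.PsiEst Gt bt n ω)
        (H.map fun x : Linf A.F =>
          ⨆ f : A.F, ((2 * A.D2 (A.Gsub P₀ f) 0) ^ (-(1 / 2) : ℝ) * x f) ^ 2) := by
  obtain rfl := hG.minimizer_eq_zero hP₀ hnull
  have : Nonempty A.F := A.F_nonempty.to_subtype
  obtain ⟨hL2, hb, Q, hQt, hQ⟩ := hG.donsker_deriv
  have hW := hQ.comp_sample (measurable_sample hZ_meas) (map_sample_eq_pi hZ_meas hZ_law hZ_indep)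
  obtain ⟨δ, c, hδ, hc, hcurv⟩ := hG.curvature_pos
  have hca : ∀ f, c ≤ A.D2 (A.Gsub P₀ f) 0 := fun f =>
    hcurv f 0 A.zero_mem_B (by simpa using hδ.le)
  have hclose : ∀ ε : ℝ, 0 < ε → ∀ᶠ p in withHighProb μ,
      BddAbove (range fun f => Gt p.1 p.2 f 0 - Gt p.1 p.2 f (bt p.1 p.2 f)) ∧
      |(p.1 : ℝ) * A.PsiEst Gt bt p.1 p.2
        - ⨆ f, (empiricalProcess hb p.1 fun j : Fin p.1 => Z j p.2) f ^ 2
          / (2 * A.D2 (A.Gsub P₀ f) 0)| ≤ ε := by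
    intro ε hε
    filter_upwards [FitFramework.eventually_abs_drop_sub_le hZ_meas hZ_law hZ_indep hG hGt hbt hb
      hW.bigOP_norm hε, eventually_pos_withHighProb] with p hp hn
    have hn' : (0 : ℝ) < p.1 := Nat.cast_pos.2 hn
    obtain ⟨⟨M, hM⟩, hsup⟩ := abs_ciSup_sub_ciSup_le (bddAbove_range_sq_div hc hca _) hp
    refine ⟨⟨M / p.1, ?_⟩, ?_⟩
    · rintro _ ⟨f, rfl⟩
      rw [le_div_iff₀ hn', mul_comm]
      exact hM ⟨f, rfl⟩
    · rwa [FitFramework.PsiEst, Real.mul_iSup_of_nonneg hn'.le]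
  have hweak := (hW.map (continuous_iSup_sq_div hc hca)).of_dist_le
    (X := fun n ω => (n : ℝ) * A.PsiEst Gt bt n ω) fun ε hε => (hclose ε hε).mono fun _ h => h.2
  refine ⟨eventually_withHighProb.1 ((hclose 1 one_pos).mono fun _ h => h.1), ?_, Q, ?_, ?_⟩
  · refine hweak.bigOP_norm.congr_norm ?_ fun n => by positivity
    filter_upwards [eventually_gt_atTop 0] with n hn ω
    have hn' : (0 : ℝ) < n := Nat.cast_pos.2 hn
    rw [hnull, sub_zero, abs_norm, Real.norm_eq_abs, abs_mul, abs_of_pos hn']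
    field_simp
  · exact isTightGaussianLaw_of_weakConv hZ_meas hZ_law hZ_indep hL2
      (FitFramework.integral_D1_influence_eq_zero hZ_meas hZ_law hZ_indep hG hGt) hb hQt hW
  · simpa only [sq_rpow_neg_half_mul (hc.trans_le (hca _))] using hweak
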